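/- Let $A=\bigoplus_{n\ge 0}A_n$ be a positively graded (associative, unital, not necessarily commutative) ring, and put $A_{\ge n}=\bigoplus_{i\ge n}A_i$. Assume that $A_{\ge 1}$ is finitely presented as a left ideal and that $A_{\ge n}$ is finitely generated as a left ideal for all sufficiently large $n$. Let $A\text{-}Gr$ be the category of $\mathbb{Z}$-graded left $A$-modules with degree-preserving $A$-linear maps. A graded module is finitely graded if all but finitely many of its homogeneous components vanish, and virtually finitely graded if each of its finitely generated graded submodules is finitely graded. Let $\mathcal{T}$ be the class of virtually finitely graded modules and, for a graded module $M$, let $t(M)$ be the largest graded submodule of $M$ that belongs to $\mathcal{T}$. Then $\mathcal{T}$ is a Serre class in $A\text{-}Gr$ (closed under subobjects, quotients and extensions), and the quotient category $A\text{-}Gr/\mathcal{T}$, i.e. the localization of $A\text{-}Gr$ at the morphisms whose kernel and cokernel lie in $\mathcal{T}$, satisfies: 1. $A\text{-}Gr/\mathcal{T}$ is locally finitely presented, i.e. it is cocomplete, its finitely presented objects (those $X$ for which $\mathrm{Hom}(X,-)$ preserves direct limits) form an essentially small class, and each object is a direct limit of finitely presented objects. 2. If moreover $\mathrm{Ext}^1_A(A_0,A/t(A))=0$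 (in the category of ungraded left $A$-modules, where $A_0$ is an $A$-module through the projection $A\to A_0$), then every flat object of $A\text{-}Gr/\mathcal{T}$ is zero. Here an object $F$ is flat if for each epimorphism $p:M\to F$ and each finitely presented object $X$, every morphism $X\to F$ factors through $p$. -/

import Mathlib

open CategoryTheory CategoryTheory.Limits DirectSum

universe u v w

section GradedModules

variable {A : Type u} [Ring A]

/-- A family of subgroups `gr n` of `M` is an internal direct sum decomposition as soon as
there are additive projections onto the `gr n`. -/
theorem isInternal_of_proj {M : Type u} [AddCommGroup M] (gr : ℤ → AddSubgroup M)
    (p : ℤ → M →+ M) (hsame : ∀ n, ∀ x ∈ gr n, p n x = x)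
    (hne : ∀ m n, m ≠ n → ∀ x ∈ gr m, p n x = 0)
    (hsum : ∀ x, x ∈ ⨆ n, gr n) : DirectSum.IsInternal gr := by
  classical
  constructor
  · rw [injective_iff_map_eq_zero]
    intro x hx
    ext n
    have key : ∀ y : ⨁ n, gr n, p n (DirectSum.coeAddMonoidHom gr y) = (y n : M) := by
      intro y
      induction y using DirectSum.induction_on with
      | zero => simp
      | of i y =>
        rw [DirectSum.coeAddMonoidHom_of]
        by_cases h : i = n
        · subst h
          rw [DirectSum.of_eq_same, hsame _ _ y.2]
        · rw [DirectSum.of_eq_of_ne _ _ _ (Ne.symm h), hne _ _ h _ y.2]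
          rfl
      | add x y hx hy => simp [hx, hy]
    rw [← key x, hx]
    simp
  · intro x
    have := hsum x
    rw [← AddSubgroup.mem_toAddSubmonoid] at this
    have h2 : (⨆ n, gr n) ≤ (DirectSum.coeAddMonoidHom gr).range := by
      refine iSup_le fun n y hy => ⟨DirectSum.of (fun n => gr n) n ⟨y, hy⟩, ?_⟩
      simp
    exact h2 (hsum x)

/-- `ℤ`-graded left modules over the `ℕ`-graded ring `A = ⨁ 𝒜 n`: the objects of `A-Gr`. -/
structure GrMod (𝒜 : ℕ → AddSubgroup A) where
  carrier : Type u
  [addCommGroup : AddCommGroup carrier]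
  [module : Module A carrier]
  /-- the homogeneous components -/
  gr : ℤ → AddSubgroup carrier
  isInternal : DirectSum.IsInternal gr
  smul_mem : ∀ (i : ℕ) (j : ℤ) (a : A) (x : carrier),
    a ∈ 𝒜 i → x ∈ gr j → a • x ∈ gr ((i : ℤ) + j)

namespace GrMod

variable {𝒜 : ℕ → AddSubgroup A}

instance : CoeSort (GrMod 𝒜) (Type u) := ⟨GrMod.carrier⟩

instance (M : GrMod 𝒜) : AddCommGroup M := M.addCommGroup

instance (M : GrMod 𝒜) : Module A M := M.module

noncomputable instance (M : GrMod 𝒜) : DirectSum.Decomposition M.gr :=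
  M.isInternal.chooseDecomposition

/-- The additive map sending an element to its homogeneous component of degree `n`. -/
noncomputable def proj (M : GrMod 𝒜) (n : ℤ) : M →+ M where
  toFun x := (DirectSum.decompose M.gr x n : M)
  map_zero' := by simp
  map_add' := by simp

theorem proj_mem (M : GrMod 𝒜) (n : ℤ) (x : M) : M.proj n x ∈ M.gr n :=
  (DirectSum.decompose M.gr x n).2

theorem proj_same (M : GrMod 𝒜) (n : ℤ) (x : M) (hx : x ∈ M.gr n) : M.proj n x = x :=
  DirectSum.decompose_of_mem_same M.gr hx

theorem proj_ne (M : GrMod 𝒜) (m n : ℤ) (h : m ≠ n) (x : M) (hx : x ∈ M.gr m) :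
    M.proj n x = 0 :=
  DirectSum.decompose_of_mem_ne M.gr hx h

theorem sum_proj (M : GrMod 𝒜) (x : M) : ∃ s : Finset ℤ, ∑ n ∈ s, M.proj n x = x := by
  classical
  exact ⟨_, DirectSum.sum_support_decompose M.gr x⟩

/-- Morphisms of `A-Gr`: the `A`-linear maps that preserve degrees. -/
@[ext]
structure Hom (M N : GrMod 𝒜) where
  toLinearMap : M →ₗ[A] N
  map_mem : ∀ (n : ℤ) (x : M), x ∈ M.gr n → toLinearMap x ∈ N.gr n

instance : Category (GrMod 𝒜) where
  Hom M N := Hom M N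
  id M := ⟨LinearMap.id, fun _ _ hx => hx⟩
  comp f g := ⟨g.toLinearMap ∘ₗ f.toLinearMap,
    fun n x hx => g.map_mem n _ (f.map_mem n x hx)⟩

/-- The linear map underlying a morphism of graded modules. -/
def lin {M N : GrMod 𝒜} (f : M ⟶ N) : M →ₗ[A] N := Hom.toLinearMap f

theorem lin_mem {M N : GrMod 𝒜} (f : M ⟶ N) (n : ℤ) (x : M) (hx : x ∈ M.gr n) :
    lin f x ∈ N.gr n := Hom.map_mem f n x hx

theorem lin_injective {M N : GrMod 𝒜} :
    Function.Injective (lin : (M ⟶ N) → (M →ₗ[A] N)) :=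
  fun _ _ h => Hom.ext h

theorem hom_ext {M N : GrMod 𝒜} {f g : M ⟶ N} (h : ∀ x, lin f x = lin g x) : f = g :=
  lin_injective (LinearMap.ext h)

@[simp] theorem lin_id (M : GrMod 𝒜) (x : M) : lin (𝟙 M) x = x := rfl

@[simp] theorem lin_comp {M N P : GrMod 𝒜} (f : M ⟶ N) (g : N ⟶ P) (x : M) :
    lin (f ≫ g) x = lin g (lin f x) := rfl

theorem lin_proj {M N : GrMod 𝒜} (f : M ⟶ N) (n : ℤ) (x : M) :
    lin f (M.proj n x) = N.proj n (lin f x) := by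
  classical
  induction x using DirectSum.Decomposition.inductionOn M.gr with
  | zero => simp
  | @homogeneous i y =>
    by_cases h : i = n
    · subst h
      rw [M.proj_same _ _ y.2, N.proj_same _ _ (lin_mem f _ _ y.2)]
    · rw [M.proj_ne _ _ h _ y.2, N.proj_ne _ _ h _ (lin_mem f _ _ y.2), map_zero]
  | add x y hx hy => simp only [map_add, hx, hy]

instance {M N : GrMod 𝒜} : Zero (M ⟶ N) :=
  ⟨(⟨0, fun n _ _ => (N.gr n).zero_mem⟩ : Hom M N)⟩

instance {M N : GrMod 𝒜} : Add (M ⟶ N) :=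
  ⟨fun f g => (⟨lin f + lin g,
    fun n x hx => (N.gr n).add_mem (lin_mem f n x hx) (lin_mem g n x hx)⟩ : Hom M N)⟩

instance {M N : GrMod 𝒜} : Neg (M ⟶ N) :=
  ⟨fun f => (⟨-lin f, fun n x hx => (N.gr n).neg_mem (lin_mem f n x hx)⟩ : Hom M N)⟩

instance {M N : GrMod 𝒜} : Sub (M ⟶ N) :=
  ⟨fun f g => (⟨lin f - lin g,
    fun n x hx => (N.gr n).sub_mem (lin_mem f n x hx) (lin_mem g n x hx)⟩ : Hom M N)⟩

instance {M N : GrMod 𝒜} : SMul ℕ (M ⟶ N) :=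
  ⟨fun k f => (⟨k • lin f,
    fun n x hx => (N.gr n).nsmul_mem (lin_mem f n x hx) k⟩ : Hom M N)⟩

instance {M N : GrMod 𝒜} : SMul ℤ (M ⟶ N) :=
  ⟨fun k f => (⟨k • lin f,
    fun n x hx => (N.gr n).zsmul_mem (lin_mem f n x hx) k⟩ : Hom M N)⟩

instance {M N : GrMod 𝒜} : AddCommGroup (M ⟶ N) :=
  lin_injective.addCommGroup lin rfl (fun _ _ => rfl) (fun _ => rfl) (fun _ _ => rfl)
    (fun _ _ => rfl) (fun _ _ => rfl)

@[simp] theorem lin_zero {M N : GrMod 𝒜} (x : M) : lin (0 : M ⟶ N) x = 0 := rfl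

@[simp] theorem lin_add {M N : GrMod 𝒜} (f g : M ⟶ N) (x : M) :
    lin (f + g) x = lin f x + lin g x := rfl

instance : Preadditive (GrMod 𝒜) where
  add_comp _ _ _ f f' g := hom_ext fun x => by simp
  comp_add _ _ _ f g g' := hom_ext fun x => by simp

/-- A homogeneous submodule, as an object of `A-Gr`. -/
def ofSubmodule (M : GrMod 𝒜) (N : Submodule A M) (hN : N.IsHomogeneous M.gr) : GrMod 𝒜 where
  carrier := N
  gr n := (M.gr n).comap N.subtype.toAddMonoidHom
  isInternal := by
    have hp : ∀ n, ∀ x ∈ N, M.proj n x ∈ N := fun n x hx => hN n hx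
    refine isInternal_of_proj _
      (fun n => ((M.proj n).comp N.subtype.toAddMonoidHom).codRestrict N
        (fun x => hp n x x.2)) ?_ ?_ ?_
    · rintro n x hx
      exact Subtype.ext (M.proj_same n _ hx)
    · rintro m n h x hx
      exact Subtype.ext (M.proj_ne m n h _ hx)
    · rintro x
      obtain ⟨s, hs⟩ := M.sum_proj x.1
      have : x = ∑ n ∈ s, (⟨M.proj n x.1, hp n _ x.2⟩ : N) := by
        apply Subtype.ext
        rw [AddSubmonoidClass.coe_finsetSum]
        exact hs.symm
      rw [this]
      refine sum_mem fun n _ => AddSubgroup.mem_iSup_of_mem n ?_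
      exact M.proj_mem n _
  smul_mem i j a x ha hx := M.smul_mem i j a x.1 ha hx

/-- The quotient by a homogeneous submodule, as an object of `A-Gr`. -/
def quotient (M : GrMod 𝒜) (N : Submodule A M) (hN : N.IsHomogeneous M.gr) : GrMod 𝒜 where
  carrier := M ⧸ N
  gr n := (M.gr n).map N.mkQ.toAddMonoidHom
  isInternal := by
    have hp : ∀ n, ∀ x ∈ N, M.proj n x ∈ N := fun n x hx => hN n hx
    refine isInternal_of_proj _
      (fun n => QuotientAddGroup.map N.toAddSubgroup N.toAddSubgroup (M.proj n) (hp n)) ?_ ?_ ?_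
    · rintro n _ ⟨x, hx, rfl⟩
      exact congrArg N.mkQ (M.proj_same n _ hx)
    · rintro m n h _ ⟨x, hx, rfl⟩
      exact (congrArg N.mkQ (M.proj_ne m n h _ hx)).trans (map_zero _)
    · intro x
      obtain ⟨x, rfl⟩ := N.mkQ_surjective x
      obtain ⟨s, hs⟩ := M.sum_proj x
      rw [← hs, map_sum]
      exact sum_mem fun n _ => AddSubgroup.mem_iSup_of_mem n ⟨_, M.proj_mem n _, rfl⟩
  smul_mem := by
    rintro i j a _ ha ⟨x, hx, rfl⟩
    exact ⟨a • x, M.smul_mem i j a x ha hx, map_smul N.mkQ a x⟩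

/-- The direct sum of two graded modules. -/
def prod (M N : GrMod 𝒜) : GrMod 𝒜 where
  carrier := M × N
  gr n := (M.gr n).prod (N.gr n)
  isInternal := by
    refine isInternal_of_proj _ (fun n => (M.proj n).prodMap (N.proj n)) ?_ ?_ ?_
    · rintro n x hx
      exact Prod.ext (M.proj_same n _ hx.1) (N.proj_same n _ hx.2)
    · rintro m n h x hx
      exact Prod.ext (M.proj_ne m n h _ hx.1) (N.proj_ne m n h _ hx.2)
    · rintro ⟨x, y⟩
      obtain ⟨s, hs⟩ := M.sum_proj x
      obtain ⟨t, ht⟩ := N.sum_proj y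
      have : (x, y) = AddMonoidHom.inl M N x + AddMonoidHom.inr M N y := by simp
      rw [this, ← hs, ← ht, map_sum, map_sum]
      exact add_mem
        (sum_mem fun n _ => AddSubgroup.mem_iSup_of_mem n ⟨M.proj_mem n _, (N.gr n).zero_mem⟩)
        (sum_mem fun n _ => AddSubgroup.mem_iSup_of_mem n ⟨(M.gr n).zero_mem, N.proj_mem n _⟩)
  smul_mem i j a x ha hx := ⟨M.smul_mem i j a _ ha hx.1, N.smul_mem i j a _ ha hx.2⟩

variable (𝒜) in
/-- The zero graded module. -/
def zeroObj : GrMod 𝒜 where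
  carrier := PUnit.{u + 1}
  gr _ := ⊥
  isInternal := isInternal_of_proj _ (fun _ => 0) (fun _ _ _ => rfl) (fun _ _ _ _ _ => rfl)
    (fun x => AddSubgroup.mem_iSup_of_mem 0 (Subsingleton.elim x 0))
  smul_mem _ _ _ _ _ _ := rfl

theorem isZero_zeroObj : IsZero (zeroObj 𝒜) := by
  rw [IsZero.iff_id_eq_zero]
  exact hom_ext fun _ => rfl

instance : HasZeroObject (GrMod 𝒜) := ⟨⟨_, isZero_zeroObj⟩⟩

instance : HasBinaryBiproducts (GrMod 𝒜) where
  has_binary_biproduct M N := hasBinaryBiproduct_of_total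
    { pt := M.prod N
      fst := (⟨LinearMap.fst A M N, fun _ _ hx => hx.1⟩ : Hom (M.prod N) M)
      snd := (⟨LinearMap.snd A M N, fun _ _ hx => hx.2⟩ : Hom (M.prod N) N)
      inl := (⟨LinearMap.inl A M N, fun n _ hx => ⟨hx, (N.gr n).zero_mem⟩⟩ : Hom M (M.prod N))
      inr := (⟨LinearMap.inr A M N, fun n _ hx => ⟨(M.gr n).zero_mem, hx⟩⟩ : Hom N (M.prod N))
      inl_fst := rfl
      inl_snd := rfl
      inr_fst := rfl
      inr_snd := rfl }
    (hom_ext fun x => by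
      refine Prod.ext ?_ ?_
      · exact add_zero x.1
      · exact zero_add x.2)

instance : HasFiniteProducts (GrMod 𝒜) :=
  hasFiniteProducts_of_has_binary_and_terminal

/-- An injective morphism whose range is the kernel of `g` is a kernel of `g`. -/
noncomputable def isKernel {K M N : GrMod 𝒜} (i : K ⟶ M) (g : M ⟶ N) (w : i ≫ g = 0)
    (inj : Function.Injective (lin i)) (ex : ∀ x, lin g x = 0 → ∃ y, lin i y = x) :
    IsLimit (KernelFork.ofι i w) := by
  have ex' : ∀ {W : GrMod 𝒜} (k : W ⟶ M), k ≫ g = 0 → ∀ x, lin k x ∈ LinearMap.range (lin i) :=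
    fun k hk x => ex _ (by rw [← lin_comp, hk, lin_zero])
  have spec : ∀ {W : GrMod 𝒜} (k : W ⟶ M) (hk : k ≫ g = 0) (x : W),
      lin i ((LinearEquiv.ofInjective (lin i) inj).symm ⟨lin k x, ex' k hk x⟩) = lin k x := by
    intro W k hk x
    have := LinearEquiv.apply_symm_apply (LinearEquiv.ofInjective (lin i) inj)
      ⟨lin k x, ex' k hk x⟩
    exact congrArg Subtype.val this
  refine KernelFork.IsLimit.ofι _ _
    (fun {W} k hk => (⟨(LinearEquiv.ofInjective (lin i) inj).symm.toLinearMap ∘ₗ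
      (lin k).codRestrict _ (ex' k hk), ?_⟩ : Hom W K)) ?_ ?_
  · intro n x hx
    have h := spec k hk x
    set y := (LinearEquiv.ofInjective (lin i) inj).symm ⟨lin k x, ex' k hk x⟩ with hy
    have h2 : K.proj n y = y := by
      apply inj
      rw [lin_proj, h, M.proj_same n _ (lin_mem k n x hx)]
    change y ∈ K.gr n
    rw [← h2]
    exact K.proj_mem n y
  · intro W k hk
    exact hom_ext fun x => spec k hk x
  · intro W k hk m hm
    refine hom_ext fun x => inj ?_
    refine Eq.trans ?_ (spec k hk x).symm
    rw [← hm]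
    rfl

/-- A surjective morphism whose kernel is the range of `f` is a cokernel of `f`. -/
noncomputable def isCokernel {M N C : GrMod 𝒜} (f : M ⟶ N) (p : N ⟶ C) (w : f ≫ p = 0)
    (surj : Function.Surjective (lin p)) (ex : ∀ x, lin p x = 0 → ∃ y, lin f y = x) :
    IsColimit (CokernelCofork.ofπ p w) := by
  have le : ∀ {W : GrMod 𝒜} (k : N ⟶ W), f ≫ k = 0 →
      LinearMap.ker (lin p) ≤ LinearMap.ker (lin k) := by
    intro W k hk x hx
    obtain ⟨y, rfl⟩ := ex x hx
    rw [LinearMap.mem_ker, ← lin_comp, hk, lin_zero]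
  have spec : ∀ {W : GrMod 𝒜} (k : N ⟶ W) (hk : f ≫ k = 0) (x : N),
      (LinearMap.ker (lin p)).liftQ (lin k) (le k hk)
        (((lin p).quotKerEquivOfSurjective surj).symm (lin p x)) = lin k x := by
    intro W k hk x
    have : ((lin p).quotKerEquivOfSurjective surj).symm (lin p x)
        = (LinearMap.ker (lin p)).mkQ x := by
      rw [LinearEquiv.symm_apply_eq]
      rfl
    rw [this]
    rfl
  refine CokernelCofork.IsColimit.ofπ _ _
    (fun {W} k hk => (⟨(LinearMap.ker (lin p)).liftQ (lin k) (le k hk) ∘ₗ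
      ((lin p).quotKerEquivOfSurjective surj).symm.toLinearMap, ?_⟩ : Hom C W)) ?_ ?_
  · intro n z hz
    obtain ⟨x, rfl⟩ := surj z
    have h2 : lin p (N.proj n x) = lin p x := by
      rw [lin_proj, C.proj_same n _ hz]
    rw [← h2]
    refine (spec k hk _).symm ▸ lin_mem k n _ (N.proj_mem n x)
  · intro W k hk
    exact hom_ext fun x => spec k hk x
  · intro W k hk m hm
    refine hom_ext fun z => ?_
    obtain ⟨x, rfl⟩ := surj z
    refine Eq.trans ?_ (spec k hk x).symm
    rw [← hm]
    rfl

theorem ker_isHomogeneous {M N : GrMod 𝒜} (f : M ⟶ N) :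
    (LinearMap.ker (lin f)).IsHomogeneous M.gr := by
  intro n x hx
  change lin f (M.proj n x) = 0
  rw [lin_proj, LinearMap.mem_ker.1 hx, map_zero]

theorem range_isHomogeneous {M N : GrMod 𝒜} (f : M ⟶ N) :
    (LinearMap.range (lin f)).IsHomogeneous N.gr := by
  rintro n _ ⟨x, rfl⟩
  exact ⟨M.proj n x, lin_proj f n x⟩

/-- The inclusion of a homogeneous submodule. -/
def subι (M : GrMod 𝒜) (N : Submodule A M) (hN : N.IsHomogeneous M.gr) :
    M.ofSubmodule N hN ⟶ M :=
  (⟨N.subtype, fun _ _ hx => hx⟩ : Hom (M.ofSubmodule N hN) M)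

/-- The projection onto the quotient by a homogeneous submodule. -/
def quotπ (M : GrMod 𝒜) (N : Submodule A M) (hN : N.IsHomogeneous M.gr) :
    M ⟶ M.quotient N hN :=
  (⟨N.mkQ, fun _ x hx => ⟨x, hx, rfl⟩⟩ : Hom M (M.quotient N hN))

theorem subι_comp {M N : GrMod 𝒜} (f : M ⟶ N) :
    M.subι _ (ker_isHomogeneous f) ≫ f = 0 :=
  hom_ext fun x => x.2

theorem comp_quotπ {M N : GrMod 𝒜} (f : M ⟶ N) :
    f ≫ N.quotπ _ (range_isHomogeneous f) = 0 :=
  hom_ext fun x => (Submodule.Quotient.mk_eq_zero _).2 ⟨x, rfl⟩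

/-- The kernel of a morphism of graded modules is its set-theoretic kernel. -/
noncomputable def isLimitKer {M N : GrMod 𝒜} (f : M ⟶ N) :
    IsLimit (KernelFork.ofι _ (subι_comp f)) :=
  isKernel _ _ _ Subtype.val_injective fun x hx => ⟨⟨x, hx⟩, rfl⟩

/-- The cokernel of a morphism of graded modules is the quotient by its range. -/
noncomputable def isColimitCoker {M N : GrMod 𝒜} (f : M ⟶ N) :
    IsColimit (CokernelCofork.ofπ _ (comp_quotπ f)) :=
  isCokernel _ _ _ (Submodule.mkQ_surjective _)
    fun _ hx => (Submodule.Quotient.mk_eq_zero _).1 hx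

instance : HasKernels (GrMod 𝒜) := ⟨fun f => ⟨_, isLimitKer f⟩⟩

instance : HasCokernels (GrMod 𝒜) := ⟨fun f => ⟨_, isColimitCoker f⟩⟩

theorem injective_of_mono {M N : GrMod 𝒜} (f : M ⟶ N) [Mono f] :
    Function.Injective (lin f) := by
  have h : M.subι _ (ker_isHomogeneous f) = 0 := by
    rw [← cancel_mono f, subι_comp, zero_comp]
  rw [injective_iff_map_eq_zero]
  intro x hx
  exact congrArg (fun g => lin g (⟨x, hx⟩ : LinearMap.ker (lin f))) h

theorem surjective_of_epi {M N : GrMod 𝒜} (f : M ⟶ N) [Epi f] :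
    Function.Surjective (lin f) := by
  have h : N.quotπ _ (range_isHomogeneous f) = 0 := by
    rw [← cancel_epi f, comp_quotπ, comp_zero]
  intro y
  exact (Submodule.Quotient.mk_eq_zero (LinearMap.range (lin f))).1
    (congrArg (fun g => lin g y) h)

/-- `A-Gr` is an abelian category. -/
noncomputable instance : Abelian (GrMod 𝒜) where
  normalMonoOfMono {_ N} f _ := ⟨
    { Z := N.quotient _ (range_isHomogeneous f)
      g := N.quotπ _ (range_isHomogeneous f)
      w := comp_quotπ f
      isLimit := isKernel _ _ _ (injective_of_mono f)
        fun _ hx => (Submodule.Quotient.mk_eq_zero (LinearMap.range (lin f))).1 hx }⟩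
  normalEpiOfEpi {M _} f _ := ⟨
    { W := M.ofSubmodule _ (ker_isHomogeneous f)
      g := M.subι _ (ker_isHomogeneous f)
      w := subι_comp f
      isColimit := isCokernel _ _ _ (surjective_of_epi f) fun x hx => ⟨⟨x, hx⟩, rfl⟩ }⟩

/-- `M` is finitely graded when `M_n = 0` for all but finitely many `n`. -/
def IsFinitelyGraded (M : GrMod 𝒜) : Prop := {n : ℤ | M.gr n ≠ ⊥}.Finite

variable (𝒜) in
/-- The class of virtually finitely graded modules: every finitely generated graded submodule
is finitely graded. -/
def virtuallyFinitelyGraded : ObjectProperty (GrMod 𝒜) := fun M =>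
  ∀ (N : Submodule A M) (hN : N.IsHomogeneous M.gr), N.FG → (M.ofSubmodule N hN).IsFinitelyGraded

/-- `t(M)`: the largest graded submodule of `M` that belongs to the class `P`, formed as the sum
of all graded submodules of `M` in `P`. -/
def torsionRadical (P : ObjectProperty (GrMod 𝒜)) (M : GrMod 𝒜) : Submodule A M :=
  sSup {N | ∃ hN : N.IsHomogeneous M.gr, P (M.ofSubmodule N hN)}

end GrMod

section GradedRing

variable (𝒜 : ℕ → AddSubgroup A) [GradedRing 𝒜]

/-- The left ideal `A_{≥ n} = ⨁_{i ≥ n} A_i`. -/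
def idealGE (n : ℕ) : Ideal A where
  carrier := {a | ∀ i < n, (DirectSum.decompose 𝒜 a i : A) = 0}
  zero_mem' := by simp
  add_mem' := by
    intro a b ha hb i hi
    simp [ha i hi, hb i hi]
  smul_mem' := by
    intro c x hx i hi
    rw [smul_eq_mul]
    induction c using DirectSum.Decomposition.inductionOn 𝒜 with
    | zero => simp
    | @homogeneous k c =>
      by_cases h : k ≤ i
      · rw [DirectSum.coe_decompose_mul_of_left_mem_of_le 𝒜 c.2 h,
          hx (i - k) (lt_of_le_of_lt (Nat.sub_le i k) hi), mul_zero]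
      · exact DirectSum.coe_decompose_mul_of_left_mem_of_not_le 𝒜 c.2 h
    | add c d hc hd =>
      rw [add_mul, DirectSum.decompose_add, DirectSum.add_apply, AddSubgroup.coe_add, hc, hd,
        add_zero]

/-- The homogeneous component of degree `n : ℤ` of `A`; it is zero for `n < 0`. -/
def ringGr : ℤ → AddSubgroup A
  | Int.ofNat n => 𝒜 n
  | Int.negSucc _ => ⊥

/-- The ring `A` as a graded left module over itself. -/
def GrMod.self : GrMod 𝒜 where
  carrier := A
  gr := ringGr 𝒜
  isInternal := by
    refine isInternal_of_proj _ (fun n => match n with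
      | Int.ofNat n => GradedRing.proj 𝒜 n
      | Int.negSucc _ => 0) ?_ ?_ ?_
    · rintro (n | n) x hx
      · exact DirectSum.decompose_of_mem_same 𝒜 hx
      · exact Eq.symm hx
    · rintro (m | m) (n | n) h x hx
      · exact DirectSum.decompose_of_mem_ne 𝒜 hx (fun e => h (congrArg Int.ofNat e))
      · rfl
      · obtain rfl : x = 0 := hx
        exact map_zero _
      · rfl
    · intro x
      classical
      rw [← DirectSum.sum_support_decompose 𝒜 x]
      exact sum_mem fun n _ => AddSubgroup.mem_iSup_of_mem (Int.ofNat n)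
        (DirectSum.decompose 𝒜 x n).2
  smul_mem := by
    rintro i (j | j) a x ha hx
    · exact SetLike.mul_mem_graded (A := 𝒜) ha hx
    · obtain rfl : x = 0 := hx
      rw [smul_zero]
      exact zero_mem _

/-- `A_0` as a left `A`-module, through the projection `A → A_0`. -/
noncomputable def zeroComponent : ModuleCat.{u} A :=
  (ModuleCat.restrictScalars (GradedRing.projZeroRingHom' 𝒜)).obj (ModuleCat.of (𝒜 0) (𝒜 0))

/-- The left `A`-module `A / t(A)`, where `t` is the torsion radical of the class of virtually
finitely graded modules. -/
noncomputable def selfModTorsion : ModuleCat.{u} A :=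
  ModuleCat.of A (GrMod.self 𝒜 ⧸
    GrMod.torsionRadical (GrMod.virtuallyFinitelyGraded 𝒜) (GrMod.self 𝒜))

end GradedRing

end GradedModules

section Flat

variable {D : Type w} [Category.{v} D]

/-- `p` is a pure epimorphism: every morphism from a finitely presented object to its target
lifts along `p`. -/
def IsPureEpi {M N : D} (p : M ⟶ N) : Prop :=
  Epi p ∧ ∀ (X : D), IsFinitelyPresentable.{u} X → ∀ f : X ⟶ N, ∃ g : X ⟶ M, g ≫ p = f

/-- `F` is flat: every epimorphism with target `F` is pure. -/
def IsFlatObject (F : D) : Prop :=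
  ∀ ⦃M : D⦄ (p : M ⟶ F), Epi p → IsPureEpi.{u} p

end Flat

/-! A graded module is virtually finitely graded exactly when each of its elements is killed by some
`A_{≥ n}` (`virtuallyFinitelyGraded_iff`), so torsion can be tested on elements without the grading.
Call `N` closed if `N → Hom(A_{≥ 1}, N)` is bijective. Since `A_{≥ 1} A_{≥ n} ⊆ A_{≥ n + 1}`, a
closed module is torsion-free and every linear map `A_{≥ n} → N` is a multiplication; hence it is
orthogonal to all maps with torsion kernel and cokernel (`bijective_comp_of_isClosedModule`).
Conversely `M → M/t(M) → colim Hom(A_{≥ n}, M/t(M))` has torsion kernel and cokernel and a closed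
target (`exists_isoModSerre_closed`). Finite generation of `A_{≥ n}` for large `n` gives closure of
torsion under extensions, closedness of that colimit, and its grading. So the quotient category is
equivalent to the reflective subcategory of closed modules.

As `A_{≥ 1}` is finitely presented, `Hom(A_{≥ 1}, -)` commutes with filtered colimits, so closed
modules are stable under them (`isClosedModule_of_isColimit`). The quotient is then an accessible
reflective localization of `A-Gr`, which is locally finitely presentable because the shifted free
modules are finitely presented and generate.

For flat objects, the `Ext` condition makes `A/t(A)` closed, and with it all direct sums of its
shifts. Up to torsion, a closed `M` is covered using only generators of degree `> e`, which gives a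
closed `P` with `P_e = 0` (`exists_closed_cover`). If `M` is flat, the map from the free module on a
generator of degree `e` that is given by `x ∈ M_e` lifts to `P`, so `x = 0`; and `e` is arbitrary.
-/

section IdealGE

/-! ### The ideals `A_{≥ n}`, torsion, and closed modules -/

variable {A : Type u} [Ring A] (𝒜 : ℕ → AddSubgroup A) [GradedRing 𝒜]

theorem idealGE_anti {m n : ℕ} (h : m ≤ n) : idealGE 𝒜 n ≤ idealGE 𝒜 m :=
  fun _ ha i hi => ha i (hi.trans_le h)

theorem mem_idealGE_of_mem {n i : ℕ} (h : n ≤ i) {a : A} (ha : a ∈ 𝒜 i) : a ∈ idealGE 𝒜 n :=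
  fun _ hj => DirectSum.decompose_of_mem_ne 𝒜 ha (by omega)

theorem idealGE_zero : idealGE 𝒜 0 = ⊤ :=
  top_le_iff.1 fun _ _ i hi => absurd hi (Nat.not_lt_zero i)

@[elab_as_elim]
theorem idealGE_induction {n : ℕ} {p : ∀ a, a ∈ idealGE 𝒜 n → Prop} (zero : p 0 (zero_mem _))
    (add : ∀ a b ha hb, p a ha → p b hb → p (a + b) (add_mem ha hb))
    (homogeneous : ∀ i (hi : n ≤ i) a (ha : a ∈ 𝒜 i), p a (mem_idealGE_of_mem 𝒜 hi ha))
    {a : A} (ha : a ∈ idealGE 𝒜 n) : p a ha := by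
  classical
  suffices ∃ h, p (∑ i ∈ (DirectSum.decompose 𝒜 a).support, (DirectSum.decompose 𝒜 a i : A)) h by
    obtain ⟨h, hp⟩ := this
    have e := DirectSum.sum_support_decompose 𝒜 a
    revert h
    rw [e]
    exact fun _ hp => hp
  refine Finset.sum_induction _ (fun b => ∃ h, p b h) ?_ ⟨_, zero⟩ fun i _ => ?_
  · rintro b c ⟨hb, pb⟩ ⟨hc, pc⟩
    exact ⟨_, add b c hb hc pb pc⟩
  · by_cases h : n ≤ i
    · exact ⟨_, homogeneous i h _ (SetLike.coe_mem _)⟩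
    · rw [ha i (not_le.1 h)]
      exact ⟨_, zero⟩

theorem homogeneous_induction {p : A → Prop} (zero : p 0)
    (add : ∀ a b, p a → p b → p (a + b)) (homogeneous : ∀ i, ∀ a ∈ 𝒜 i, p a) (a : A) : p a :=
  idealGE_induction 𝒜 (n := 0) (p := fun a _ => p a) zero (fun a b _ _ => add a b)
    (fun i _ => homogeneous i) (a := a) (by rw [idealGE_zero]; trivial)

theorem decompose_mem_idealGE {n : ℕ} {a : A} (ha : a ∈ idealGE 𝒜 n) (i : ℕ) :
    (DirectSum.decompose 𝒜 a i : A) ∈ idealGE 𝒜 n := by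
  by_cases h : n ≤ i
  · exact mem_idealGE_of_mem 𝒜 h (SetLike.coe_mem _)
  · rw [ha i (not_le.1 h)]
    exact zero_mem _

theorem mul_mem_idealGE_add {m n : ℕ} {a b : A} (ha : a ∈ idealGE 𝒜 m) (hb : b ∈ idealGE 𝒜 n) :
    a * b ∈ idealGE 𝒜 (m + n) := by
  induction ha using idealGE_induction with
  | zero => rw [zero_mul]; exact zero_mem _
  | add a a' _ _ h h' => rw [add_mul]; exact add_mem h h'
  | homogeneous i hi a ha =>
    induction hb using idealGE_induction with
    | zero => rw [mul_zero]; exact zero_mem _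
    | add b b' _ _ h h' => rw [mul_add]; exact add_mem h h'
    | homogeneous j hj b hb =>
      exact mem_idealGE_of_mem 𝒜 (add_le_add hi hj) (SetLike.mul_mem_graded ha hb)

theorem mul_mem_idealGE_of_left {n : ℕ} {a : A} (ha : a ∈ idealGE 𝒜 n) (b : A) :
    a * b ∈ idealGE 𝒜 n :=
  mul_mem_idealGE_add 𝒜 (n := 0) ha (by rw [idealGE_zero]; trivial)

theorem exists_homogeneous_generators {n : ℕ} (h : (idealGE 𝒜 n).FG) :
    ∃ s : Finset A, Ideal.span (s : Set A) = idealGE 𝒜 n ∧ ∀ a ∈ s, ∃ i, a ∈ 𝒜 i := by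
  classical
  obtain ⟨s, hs⟩ := h
  refine ⟨s.biUnion fun a => (DirectSum.decompose 𝒜 a).support.image
    fun i => (DirectSum.decompose 𝒜 a i : A), le_antisymm ?_ ?_, ?_⟩
  · rw [Ideal.span_le]
    intro b hb
    obtain ⟨a, ha, hb⟩ := Finset.mem_biUnion.1 hb
    obtain ⟨i, _, rfl⟩ := Finset.mem_image.1 hb
    exact decompose_mem_idealGE 𝒜 (hs ▸ Submodule.subset_span ha) i
  · rw [← hs]
    refine Submodule.span_le.2 fun a ha => ?_
    rw [← DirectSum.sum_support_decompose 𝒜 a]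
    exact sum_mem fun i hi => Submodule.subset_span
      (Finset.mem_biUnion.2 ⟨a, ha, Finset.mem_image_of_mem _ hi⟩)
  · intro b hb
    obtain ⟨a, _, hb⟩ := Finset.mem_biUnion.1 hb
    obtain ⟨i, _, rfl⟩ := Finset.mem_image.1 hb
    exact ⟨i, SetLike.coe_mem _⟩

section Torsion

variable (M : Type*) [AddCommGroup M] [Module A M]

/-- The submodule of the elements annihilated by some `A_{≥ n}`. -/
def boundedTorsion : Submodule A M where
  carrier := {x | ∃ n, ∀ a ∈ idealGE 𝒜 n, a • x = 0}
  zero_mem' := ⟨0, fun _ _ => smul_zero _⟩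
  add_mem' := by
    rintro x y ⟨m, hm⟩ ⟨n, hn⟩
    refine ⟨max m n, fun a ha => ?_⟩
    rw [smul_add, hm a (idealGE_anti 𝒜 (le_max_left m n) ha),
      hn a (idealGE_anti 𝒜 (le_max_right m n) ha), add_zero]
  smul_mem' := by
    rintro c x ⟨n, hn⟩
    exact ⟨n, fun a ha => by rw [smul_smul]; exact hn _ (mul_mem_idealGE_of_left 𝒜 ha c)⟩

variable {M}

theorem map_mem_boundedTorsion {N : Type*} [AddCommGroup N] [Module A N] (f : M →ₗ[A] N) {x : M}
    (hx : x ∈ boundedTorsion 𝒜 M) : f x ∈ boundedTorsion 𝒜 N := by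
  obtain ⟨n, hn⟩ := hx
  exact ⟨n, fun a ha => by rw [← map_smul, hn a ha, map_zero]⟩

theorem exists_forall_idealGE {ι : Type*} (s : Finset ι) (p : ι → A → Prop)
    (h : ∀ i ∈ s, ∃ n, ∀ a ∈ idealGE 𝒜 n, p i a) :
    ∃ n, ∀ i ∈ s, ∀ a ∈ idealGE 𝒜 n, p i a := by
  choose! n hn using h
  exact ⟨s.sup n, fun i hi a ha => hn i hi a (idealGE_anti 𝒜 (Finset.le_sup hi) ha)⟩

/-- This gives closure under extensions. If finitely many homogeneous `b` generate some `A_{≥ k}`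
with `k ≥ n`, a single `A_{≥ m}` kills all `b • x`, and elements of high degree are combinations of
the `b` with coefficients in `A_{≥ m}`. -/
theorem mem_boundedTorsion_of_forall (hfg : ∀ᶠ n in Filter.atTop, (idealGE 𝒜 n).FG) {x : M}
    {n : ℕ} (h : ∀ a ∈ idealGE 𝒜 n, a • x ∈ boundedTorsion 𝒜 M) : x ∈ boundedTorsion 𝒜 M := by
  classical
  obtain ⟨k, hk, hnk⟩ := (hfg.and (Filter.eventually_ge_atTop n)).exists
  obtain ⟨s, hs, hom⟩ := exists_homogeneous_generators 𝒜 hk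
  obtain ⟨m, hm⟩ := exists_forall_idealGE 𝒜 s (fun b a => a • b • x = 0)
    fun b hb => h b (idealGE_anti 𝒜 hnk (hs ▸ Submodule.subset_span hb))
  choose! d hd using hom
  refine ⟨m + s.sup d + k, fun a ha => ?_⟩
  induction ha using idealGE_induction with
  | zero => exact zero_smul _ _
  | add a b _ _ ha hb => rw [add_smul, ha, hb, add_zero]
  | homogeneous i hi a ha =>
    have hak : a ∈ Ideal.span (s : Set A) := by
      rw [hs]; exact mem_idealGE_of_mem 𝒜 (by omega) ha
    obtain ⟨f, -, hf⟩ := Submodule.mem_span_finset.1 hak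
    -- In `a = ∑ f b * b` only parts of degree `i` count, so `f b` may be replaced by its component
    -- of degree `i - d b ≥ m`.
    rw [← DirectSum.decompose_of_mem_same 𝒜 ha, ← hf, DirectSum.decompose_sum,
      DFinsupp.finsetSum_apply, AddSubmonoidClass.coe_finsetSum, Finset.sum_smul]
    refine Finset.sum_eq_zero fun b hb => ?_
    have hdb : d b ≤ s.sup d := Finset.le_sup hb
    rw [smul_eq_mul, DirectSum.coe_decompose_mul_of_right_mem_of_le 𝒜 (hd b hb) (by omega),
      mul_smul]
    exact hm b hb _ (mem_idealGE_of_mem 𝒜 (by omega) (SetLike.coe_mem _))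

theorem boundedTorsion_quotient_eq_bot (hfg : ∀ᶠ n in Filter.atTop, (idealGE 𝒜 n).FG) :
    boundedTorsion 𝒜 (M ⧸ boundedTorsion 𝒜 M) = ⊥ := by
  rw [eq_bot_iff]
  intro x hx
  obtain ⟨x, rfl⟩ := Submodule.mkQ_surjective _ x
  obtain ⟨n, hn⟩ := hx
  exact (Submodule.Quotient.mk_eq_zero _).2 (mem_boundedTorsion_of_forall 𝒜 hfg fun a ha =>
    (Submodule.Quotient.mk_eq_zero _).1 (hn a ha))

theorem eq_of_forall_smul_eq (ht : boundedTorsion 𝒜 M = ⊥) {n : ℕ} {x y : M}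
    (h : ∀ a ∈ idealGE 𝒜 n, a • x = a • y) : x = y := by
  have : x - y ∈ boundedTorsion 𝒜 M := ⟨n, fun a ha => by rw [smul_sub, h a ha, sub_self]⟩
  rw [ht] at this
  exact sub_eq_zero.1 this

end Torsion

section Closed

/-- Every linear map `A_{≥ 1} → N` is the multiplication by a unique element of `N`. -/
def IsClosedModule (N : Type*) [AddCommGroup N] [Module A N] : Prop :=
  ∀ φ : idealGE 𝒜 1 →ₗ[A] N, ∃! x : N, ∀ a, φ a = (a : A) • x

variable {N : Type*} [AddCommGroup N] [Module A N]

theorem IsClosedModule.of_torsionFree (ht : boundedTorsion 𝒜 N = ⊥)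
    (h : ∀ φ : idealGE 𝒜 1 →ₗ[A] N, ∃ x : N, ∀ a, φ a = (a : A) • x) : IsClosedModule 𝒜 N := by
  intro φ
  obtain ⟨x, hx⟩ := h φ
  exact ⟨x, hx, fun y hy => eq_of_forall_smul_eq 𝒜 ht (n := 1) fun a ha =>
    (hy ⟨a, ha⟩).symm.trans (hx ⟨a, ha⟩)⟩

variable {𝒜}

/-- If `A_{≥ n + 1}` kills `x` and `a ∈ A_{≥ n}`, then `a • x` and `0` both represent the zero map
on `A_{≥ 1}`, so they agree; descend on `n`. -/
theorem IsClosedModule.torsionFree (hN : IsClosedModule 𝒜 N) : boundedTorsion 𝒜 N = ⊥ := by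
  rw [eq_bot_iff]
  rintro x ⟨n, hn⟩
  induction n generalizing x with
  | zero =>
    have := hn 1 (by rw [idealGE_zero]; trivial)
    rwa [one_smul] at this
  | succ n ih =>
    refine ih fun a ha => ?_
    refine (hN 0).unique (fun b => ?_) (fun b => (smul_zero _).symm)
    rw [smul_smul, hn _ (by rw [add_comm]; exact mul_mem_idealGE_add 𝒜 b.2 ha)]
    rfl

/-- For `a ∈ A_{≥ n}` the map `b ↦ φ (b * a)` on `A_{≥ 1}` is multiplication by a unique `ψ a`.
Uniqueness makes `ψ` linear on `A_{≥ n}`, and the induction applies to `ψ`. -/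
theorem IsClosedModule.exists_eq_smul (hN : IsClosedModule 𝒜 N) (n : ℕ)
    (φ : idealGE 𝒜 n →ₗ[A] N) : ∃ x : N, ∀ a, φ a = (a : A) • x := by
  induction n with
  | zero =>
    refine ⟨φ ⟨1, by rw [idealGE_zero]; trivial⟩, fun a => ?_⟩
    rw [← map_smul]
    exact congrArg φ (Subtype.ext (mul_one _).symm)
  | succ n ih =>
    have hmem : ∀ (a : idealGE 𝒜 n) (b : idealGE 𝒜 1), (b : A) * a ∈ idealGE 𝒜 (n + 1) :=
      fun a b => by rw [add_comm]; exact mul_mem_idealGE_add 𝒜 b.2 a.2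
    have key : ∀ a : idealGE 𝒜 n, ∃ x : N, ∀ b : idealGE 𝒜 1, φ ⟨_, hmem a b⟩ = (b : A) • x := by
      intro a
      obtain ⟨x, hx, -⟩ := hN
        { toFun := fun b => φ ⟨_, hmem a b⟩
          map_add' := fun b c => by
            rw [← map_add]; exact congrArg φ (Subtype.ext (add_mul _ _ _))
          map_smul' := fun c b => by
            rw [RingHom.id_apply, ← map_smul]; exact congrArg φ (Subtype.ext (mul_assoc _ _ _)) }
      exact ⟨x, hx⟩
    choose ψ hψ using key
    have huniq : ∀ x y : N, (∀ b : idealGE 𝒜 1, (b : A) • x = (b : A) • y) → x = y :=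
      fun x y h => eq_of_forall_smul_eq 𝒜 hN.torsionFree (n := 1) fun b hb => h ⟨b, hb⟩
    obtain ⟨x, hx⟩ := ih
      { toFun := ψ
        map_add' := fun a a' => huniq _ _ fun b => by
          rw [smul_add, ← hψ, ← hψ, ← hψ, ← map_add]
          exact congrArg φ (Subtype.ext (mul_add _ _ _))
        map_smul' := fun c a => huniq _ _ fun b => by
          rw [RingHom.id_apply, smul_smul, ← hψ]
          have := hψ a ⟨b * c, mul_mem_idealGE_of_left 𝒜 b.2 c⟩
          rw [← this]
          exact congrArg φ (Subtype.ext (mul_assoc _ _ _).symm) }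
    refine ⟨x, fun a => huniq _ _ fun b => ?_⟩
    have h1 := hψ ⟨a, idealGE_anti 𝒜 (Nat.le_succ n) a.2⟩ b
    have h2 : ψ ⟨a, idealGE_anti 𝒜 (Nat.le_succ n) a.2⟩ = (a : A) • x :=
      hx ⟨a, idealGE_anti 𝒜 (Nat.le_succ n) a.2⟩
    rw [← h2, ← h1, ← map_smul]
    rfl

/-- Closed modules are orthogonal to the maps with torsion kernel and cokernel. -/
theorem IsClosedModule.exists_extension (hN : IsClosedModule 𝒜 N) {X Y : Type*} [AddCommGroup X]
    [Module A X] [AddCommGroup Y] [Module A Y] (f : X →ₗ[A] Y)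
    (hker : LinearMap.ker f ≤ boundedTorsion 𝒜 X)
    (hcoker : ∀ y, ∃ n, ∀ a ∈ idealGE 𝒜 n, a • y ∈ LinearMap.range f) (h : X →ₗ[A] N) :
    ∃ g : Y →ₗ[A] N, g ∘ₗ f = h := by
  have hle : LinearMap.ker f ≤ LinearMap.ker h := fun x hx => by
    have := map_mem_boundedTorsion 𝒜 h (hker hx)
    rwa [hN.torsionFree] at this
  let k : LinearMap.range f →ₗ[A] N :=
    (LinearMap.ker f).liftQ h hle ∘ₗ f.quotKerEquivRange.symm.toLinearMap
  have hk : ∀ x, k ⟨f x, x, rfl⟩ = h x := by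
    intro x
    have : f.quotKerEquivRange.symm ⟨f x, x, rfl⟩ = (LinearMap.ker f).mkQ x := by
      rw [LinearEquiv.symm_apply_eq]
      rfl
    exact congrArg ((LinearMap.ker f).liftQ h hle) this
  -- For `A_{≥ n} y` inside the range, `a ↦ k (a • y)` is multiplication by some `z`, the only
  -- candidate for the value at `y`. Torsion-freeness makes it independent of `n` and linear in `y`.
  have key : ∀ y, ∃ z : N, ∃ n, ∀ a ∈ idealGE 𝒜 n,
      ∃ hy : a • y ∈ LinearMap.range f, k ⟨a • y, hy⟩ = a • z := by
    intro y
    obtain ⟨n, hn⟩ := hcoker y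
    obtain ⟨z, hz⟩ := hN.exists_eq_smul n (k ∘ₗ
      (((LinearMap.toSpanSingleton A Y y).domRestrict (idealGE 𝒜 n)).codRestrict _
        fun a => hn a a.2))
    exact ⟨z, n, fun a ha => ⟨hn a ha, hz ⟨a, ha⟩⟩⟩
  choose g n hy hg using key
  refine ⟨{ toFun := g, map_add' := fun x y => ?_, map_smul' := fun c y => ?_ }, ?_⟩
  · refine eq_of_forall_smul_eq 𝒜 hN.torsionFree (n := max (max (n x) (n y)) (n (x + y)))
      fun a ha => ?_
    have h1 := idealGE_anti 𝒜 (((le_max_left _ _).trans (le_max_left _ _))) ha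
    have h2 := idealGE_anti 𝒜 (((le_max_right _ _).trans (le_max_left _ _))) ha
    have h3 := idealGE_anti 𝒜 ((le_max_right _ _)) ha
    rw [smul_add, ← hg _ a h1, ← hg _ a h2, ← hg _ a h3, ← map_add]
    exact congrArg k (Subtype.ext (smul_add _ _ _))
  · refine eq_of_forall_smul_eq 𝒜 hN.torsionFree (n := max (n y) (n (c • y))) fun a ha => ?_
    have h1 := idealGE_anti 𝒜 ((le_max_left _ _)) ha
    have h2 := idealGE_anti 𝒜 ((le_max_right _ _)) ha
    rw [RingHom.id_apply, smul_smul, ← hg _ a h2, ← hg y _ (mul_mem_idealGE_of_left 𝒜 h1 c)]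
    exact congrArg k (Subtype.ext (smul_smul _ _ _))
  · ext x
    refine eq_of_forall_smul_eq 𝒜 hN.torsionFree (n := n (f x)) fun a ha => ?_
    refine (hg _ a ha).symm.trans (Eq.trans ?_ (map_smul h a x))
    rw [← hk]
    exact congrArg k (Subtype.ext (map_smul f a x).symm)

theorem eq_of_comp_eq_of_torsion_coker (ht : boundedTorsion 𝒜 N = ⊥) {X Y : Type*} [AddCommGroup X]
    [Module A X] [AddCommGroup Y] [Module A Y] (f : X →ₗ[A] Y)
    (hcoker : ∀ y, ∃ n, ∀ a ∈ idealGE 𝒜 n, a • y ∈ LinearMap.range f) {g h : Y →ₗ[A] N}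
    (e : ∀ x, g (f x) = h (f x)) : g = h := by
  ext y
  obtain ⟨n, hn⟩ := hcoker y
  refine eq_of_forall_smul_eq 𝒜 ht (n := n) fun a ha => ?_
  obtain ⟨x, hx⟩ := hn a ha
  rw [← map_smul, ← map_smul, ← hx, e]

end Closed

end IdealGE

/-! ### Torsion in graded modules and the Serre class -/

namespace GrMod

section

variable {A : Type u} [Ring A] {𝒜 : ℕ → AddSubgroup A}

theorem induction_on_homogeneous (M : GrMod 𝒜) {p : M → Prop} (zero : p 0)
    (add : ∀ x y, p x → p y → p (x + y)) (homogeneous : ∀ i, ∀ x ∈ M.gr i, p x) (x : M) : p x := by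
  obtain ⟨s, hs⟩ := M.sum_proj x
  rw [← hs]
  exact Finset.sum_induction _ p add zero fun i _ => homogeneous i _ (M.proj_mem i x)

theorem proj_smul (M : GrMod 𝒜) {i : ℕ} {a : A} (ha : a ∈ 𝒜 i) (j : ℤ) (x : M) :
    M.proj (i + j) (a • x) = a • M.proj j x := by
  induction x using induction_on_homogeneous with
  | zero => simp
  | add x y hx hy => simp only [smul_add, map_add, hx, hy]
  | homogeneous k x hx =>
    have h := M.smul_mem i k a x ha hx
    by_cases hk : k = j
    · subst hk
      rw [M.proj_same _ _ h, M.proj_same _ _ hx]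
    · rw [M.proj_ne _ _ (by omega) _ h, M.proj_ne _ _ hk _ hx, smul_zero]

theorem ext_proj (M : GrMod 𝒜) {x y : M} (h : ∀ n, M.proj n x = M.proj n y) : x = y := by
  obtain ⟨s, hs⟩ := M.sum_proj (x - y)
  rw [← sub_eq_zero, ← hs]
  exact Finset.sum_eq_zero fun n _ => by rw [map_sub, h, sub_self]

theorem finite_support (M : GrMod 𝒜) (x : M) : {n | M.proj n x ≠ 0}.Finite := by
  classical
  refine (DirectSum.decompose M.gr x).support.finite_toSet.subset fun n hn => ?_
  rw [Finset.mem_coe, DFinsupp.mem_support_iff]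
  exact fun h => hn (congrArg Subtype.val h)

theorem sum_proj_of_subset (M : GrMod 𝒜) (x : M) {s : Finset ℤ} (hs : ∀ n, M.proj n x ≠ 0 → n ∈ s) :
    ∑ n ∈ s, M.proj n x = x := by
  classical
  refine M.ext_proj fun m => ?_
  rw [map_sum, Finset.sum_eq_single m]
  · exact M.proj_same _ _ (M.proj_mem _ _)
  · exact fun n _ hn => M.proj_ne _ _ hn _ (M.proj_mem _ _)
  · intro hm
    rw [not_not.1 (mt (hs m) hm), map_zero]

theorem mem_gr_iff (M : GrMod 𝒜) {n : ℤ} {x : M} : x ∈ M.gr n ↔ M.proj n x = x :=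
  ⟨M.proj_same n x, fun h => h ▸ M.proj_mem n x⟩

theorem exists_lin_eq_of_shortExact {S : ShortComplex (GrMod 𝒜)} (hS : S.ShortExact) {x : S.X₂}
    (hx : lin S.g x = 0) : ∃ y, lin S.f y = x := by
  obtain ⟨l, hl⟩ := KernelFork.IsLimit.lift' hS.fIsKernel _ (subι_comp S.g)
  exact ⟨lin l ⟨x, hx⟩, congrArg (fun k => lin k (⟨x, hx⟩ : LinearMap.ker (lin S.g))) hl⟩

end

variable {A : Type u} [Ring A] {𝒜 : ℕ → AddSubgroup A} [GradedRing 𝒜]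

theorem boundedTorsion_isHomogeneous (M : GrMod 𝒜) :
    (boundedTorsion 𝒜 M).IsHomogeneous M.gr := by
  rintro k x ⟨n, hn⟩
  refine ⟨n, fun a ha => ?_⟩
  change a • M.proj k x = 0
  induction ha using idealGE_induction with
  | zero => exact zero_smul _ _
  | add a b _ _ ha hb => rw [add_smul, ha, hb, add_zero]
  | homogeneous i hi a ha =>
    rw [← M.proj_smul ha, hn a (mem_idealGE_of_mem 𝒜 hi ha), map_zero]

theorem span_singleton_isHomogeneous (M : GrMod 𝒜) {k : ℤ} {x : M} (hx : x ∈ M.gr k) :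
    (Submodule.span A {x}).IsHomogeneous M.gr := by
  intro n y hy
  obtain ⟨c, rfl⟩ := Submodule.mem_span_singleton.1 hy
  change M.proj n (c • x) ∈ _
  induction c using homogeneous_induction 𝒜 with
  | zero => rw [zero_smul, map_zero]; exact zero_mem _
  | add a b ha hb =>
    rw [add_smul, map_add]
    exact add_mem (ha (Submodule.mem_span_singleton.2 ⟨a, rfl⟩))
      (hb (Submodule.mem_span_singleton.2 ⟨b, rfl⟩))
  | homogeneous i a ha =>
    have h := M.smul_mem i k a x ha hx
    by_cases hn : (i : ℤ) + k = n
    · subst hn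
      rw [M.proj_same _ _ h]
      exact hy
    · rw [M.proj_ne _ _ hn _ h]
      exact zero_mem _

theorem virtuallyFinitelyGraded_iff (M : GrMod 𝒜) :
    virtuallyFinitelyGraded 𝒜 M ↔ ∀ x : M, x ∈ boundedTorsion 𝒜 M := by
  constructor
  · intro h x
    induction x using induction_on_homogeneous with
    | zero => exact zero_mem _
    | add x y hx hy => exact add_mem hx hy
    | homogeneous k x hx =>
      have hfin := h _ (M.span_singleton_isHomogeneous hx) (Submodule.fg_span_singleton x)
      obtain ⟨b, hb⟩ := hfin.bddAbove
      -- All degrees of `A x` are at most `b`, and `i ≥ b - k + 1` puts `a • x` in degree `i + k >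
      -- b`.
      refine ⟨(b - k + 1).toNat, fun a ha => ?_⟩
      induction ha using idealGE_induction with
      | zero => exact zero_smul _ _
      | add a b _ _ ha hb => rw [add_smul, ha, hb, add_zero]
      | homogeneous i hi a ha =>
        by_contra hne
        have : ((i : ℤ) + k) ∈ {n | (M.ofSubmodule _ (M.span_singleton_isHomogeneous hx)).gr n ≠ ⊥} :=
          fun hbot => hne <| by
            have hmem : (⟨a • x, Submodule.mem_span_singleton.2 ⟨a, rfl⟩⟩ : Submodule.span A {x}) ∈
              (M.ofSubmodule _ (M.span_singleton_isHomogeneous hx)).gr (i + k) :=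
                M.smul_mem i k a x ha hx
            rw [hbot] at hmem
            exact congrArg Subtype.val hmem
        have := hb this
        omega
  · intro h N hN hfg
    obtain ⟨s, hs⟩ := hfg
    obtain ⟨m, hm⟩ := exists_forall_idealGE 𝒜 s (fun x a => a • x = 0) fun x _ => h x
    -- Since `A_{≥ m}` kills the generators, degrees of `N` can only be a degree below `m` plus a
    -- degree occurring in a generator.
    have hfin : (⋃ x ∈ (s : Set M), ⋃ i ∈ (Finset.range m : Set ℕ),
        (fun l : ℤ => (i : ℤ) + l) '' {l | M.proj l x ≠ 0}).Finite :=
      s.finite_toSet.biUnion fun x _ => (Finset.range m).finite_toSet.biUnion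
        fun i _ => (M.finite_support x).image _
    refine hfin.subset fun n hn => ?_
    by_contra hnot
    refine hn ((AddSubgroup.eq_bot_iff_forall _).2 fun y hy => Subtype.ext ?_)
    have hy' : M.proj n y.1 = y.1 := M.proj_same n _ hy
    refine hy'.symm.trans ?_
    have hmem : y.1 ∈ Submodule.span A (s : Set M) := hs ▸ y.2
    obtain ⟨f, -, hf⟩ := Submodule.mem_span_finset.1 hmem
    rw [← hf, map_sum]
    refine Finset.sum_eq_zero fun x hx => ?_
    induction f x using homogeneous_induction 𝒜 with
    | zero => rw [zero_smul, map_zero]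
    | add a b ha hb => rw [add_smul, map_add, ha, hb, add_zero]
    | homogeneous i a ha =>
      by_cases hi : m ≤ i
      · rw [hm x hx a (mem_idealGE_of_mem 𝒜 hi ha), map_zero]
      · have e := M.proj_smul ha (n - i) x
        rw [add_sub_cancel] at e
        rw [e]
        by_contra hne
        refine hnot (Set.mem_biUnion hx (Set.mem_biUnion
          (Finset.mem_coe.2 (Finset.mem_range.2 (not_le.1 hi))) ⟨n - i, fun h0 => hne ?_, ?_⟩))
        · rw [h0, smul_zero]
        · exact add_sub_cancel _ _

theorem torsionRadical_eq (M : GrMod 𝒜) :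
    torsionRadical (virtuallyFinitelyGraded 𝒜) M = boundedTorsion 𝒜 M := by
  refine le_antisymm (sSup_le ?_) (le_sSup ⟨M.boundedTorsion_isHomogeneous, ?_⟩)
  · rintro N ⟨hN, h⟩ x hx
    exact map_mem_boundedTorsion 𝒜 N.subtype ((virtuallyFinitelyGraded_iff _).1 h ⟨x, hx⟩)
  · refine (virtuallyFinitelyGraded_iff _).2 ?_
    rintro ⟨x, n, hn⟩
    exact ⟨n, fun a ha => Subtype.ext (hn a ha)⟩

theorem virtuallyFinitelyGraded_of_injective {M N : GrMod 𝒜} (f : M ⟶ N)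
    (hf : Function.Injective (lin f)) (hN : virtuallyFinitelyGraded 𝒜 N) :
    virtuallyFinitelyGraded 𝒜 M := by
  rw [virtuallyFinitelyGraded_iff] at hN ⊢
  intro x
  obtain ⟨n, hn⟩ := hN (lin f x)
  exact ⟨n, fun a ha => hf (by rw [map_smul, hn a ha, map_zero])⟩

theorem virtuallyFinitelyGraded_of_surjective {M N : GrMod 𝒜} (f : M ⟶ N)
    (hf : Function.Surjective (lin f)) (hM : virtuallyFinitelyGraded 𝒜 M) :
    virtuallyFinitelyGraded 𝒜 N := by
  rw [virtuallyFinitelyGraded_iff] at hM ⊢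
  intro y
  obtain ⟨x, rfl⟩ := hf y
  exact map_mem_boundedTorsion 𝒜 _ (hM x)

/-- Only closure under extensions needs finite generation: `A_{≥ n} x` comes from the torsion
submodule, so `mem_boundedTorsion_of_forall` applies. -/
theorem isSerreClass (hfg : ∀ᶠ n in Filter.atTop, (idealGE 𝒜 n).FG) :
    (virtuallyFinitelyGraded 𝒜).IsSerreClass where
  exists_zero := ⟨_, isZero_zeroObj, (virtuallyFinitelyGraded_iff _).2
    fun x => (show x = 0 from rfl) ▸ zero_mem _⟩
  prop_of_mono f _ := virtuallyFinitelyGraded_of_injective f (injective_of_mono f)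
  prop_of_epi f _ := virtuallyFinitelyGraded_of_surjective f (surjective_of_epi f)
  prop_X₂_of_shortExact {S} hS h₁ h₃ := by
    rw [virtuallyFinitelyGraded_iff] at h₁ h₃ ⊢
    intro x
    obtain ⟨n, hn⟩ := h₃ (lin S.g x)
    refine mem_boundedTorsion_of_forall 𝒜 hfg (n := n) fun a ha => ?_
    obtain ⟨y, hy⟩ := exists_lin_eq_of_shortExact hS (x := a • x) (by rw [map_smul, hn a ha])
    rw [← hy]
    exact map_mem_boundedTorsion 𝒜 _ (h₁ y)

theorem isoModSerre_iff [(virtuallyFinitelyGraded 𝒜).IsSerreClass] {X Y : GrMod 𝒜} (f : X ⟶ Y) :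
    (virtuallyFinitelyGraded 𝒜).isoModSerre f ↔
      LinearMap.ker (lin f) ≤ boundedTorsion 𝒜 X ∧
      ∀ y, ∃ n, ∀ a ∈ idealGE 𝒜 n, a • y ∈ LinearMap.range (lin f) := by
  rw [ObjectProperty.isoModSerre_iff, ObjectProperty.monoModSerre_iff,
    ObjectProperty.epiModSerre_iff]
  refine and_congr
    (((virtuallyFinitelyGraded 𝒜).prop_iff_of_iso
      ((kernelIsKernel f).conePointUniqueUpToIso (isLimitKer f))).trans ?_)
    (((virtuallyFinitelyGraded 𝒜).prop_iff_of_iso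
      ((cokernelIsCokernel f).coconePointUniqueUpToIso (isColimitCoker f))).trans ?_)
  · refine (virtuallyFinitelyGraded_iff _).trans ⟨fun h x hx => ?_, fun h x => ?_⟩
    · exact map_mem_boundedTorsion 𝒜 (LinearMap.ker (lin f)).subtype (h ⟨x, hx⟩)
    · obtain ⟨n, hn⟩ := h x.2
      exact ⟨n, fun a ha => Subtype.ext (hn a ha)⟩
  · refine (virtuallyFinitelyGraded_iff _).trans ⟨fun h y => ?_, fun h y => ?_⟩
    · obtain ⟨n, hn⟩ := h ((LinearMap.range (lin f)).mkQ y)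
      exact ⟨n, fun a ha => (Submodule.Quotient.mk_eq_zero _).1 (hn a ha)⟩
    · obtain ⟨y, rfl⟩ := (LinearMap.range (lin f)).mkQ_surjective y
      obtain ⟨n, hn⟩ := h y
      exact ⟨n, fun a ha => (Submodule.Quotient.mk_eq_zero _).2 (hn a ha)⟩

/-- Graded modules whose underlying module is closed are orthogonal to `isoModSerre`. -/
theorem bijective_comp_of_isClosedModule [(virtuallyFinitelyGraded 𝒜).IsSerreClass]
    {X Y N : GrMod 𝒜} (hN : IsClosedModule 𝒜 N) (f : X ⟶ Y)
    (hf : (virtuallyFinitelyGraded 𝒜).isoModSerre f) :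
    Function.Bijective fun g : Y ⟶ N => f ≫ g := by
  obtain ⟨hker, hcoker⟩ := (isoModSerre_iff f).1 hf
  constructor
  · intro g h e
    exact lin_injective (eq_of_comp_eq_of_torsion_coker (𝒜 := 𝒜) hN.torsionFree (lin f) hcoker
      fun x => congrArg (fun k => lin k x) e)
  · intro h
    obtain ⟨g, hg⟩ := hN.exists_extension (lin f) hker hcoker (lin h)
    have hg' : ∀ x, g (lin f x) = lin h x := LinearMap.congr_fun hg
    refine ⟨(⟨g, fun k y hy => ?_⟩ : Hom Y N), hom_ext hg'⟩
    -- The ungraded extension preserves degrees: `g y` and its component of degree `k` agree after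
    -- multiplication by a homogeneous `a` deep enough that `a • y` lies in the range of `f`, where
    -- `g` is the graded map `h`.
    rw [N.mem_gr_iff]
    obtain ⟨n, hn⟩ := hcoker y
    refine eq_of_forall_smul_eq 𝒜 hN.torsionFree (n := n) fun a ha => ?_
    induction ha using idealGE_induction with
    | zero => simp
    | add a b _ _ ha hb => simp only [add_smul, ha, hb]
    | homogeneous i hi a ha =>
      obtain ⟨x, hx⟩ := hn a (mem_idealGE_of_mem 𝒜 hi ha)
      rw [← N.proj_smul ha, ← map_smul, ← hx, hg', ← lin_proj, ← hg', ← hg', lin_proj, hx,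
        Y.proj_same _ _ (Y.smul_mem i k a y ha hy)]

end GrMod

/-! ### The module of germs `colim Hom(A_{≥ n}, M)` -/

section Coinduced

variable {A : Type u} [Ring A]

variable (A) in
/-- The additive maps `A → M`, as an `A`-module with `(a • φ) x = φ (x * a)`. -/
def Coinduced (M : Type u) [AddCommGroup M] : Type u := A →+ M

namespace Coinduced

variable (𝒜 : ℕ → AddSubgroup A) [GradedRing 𝒜]
variable {M : Type u} [AddCommGroup M]

instance : AddCommGroup (Coinduced A M) := inferInstanceAs (AddCommGroup (A →+ M))

instance : FunLike (Coinduced A M) A M := inferInstanceAs (FunLike (A →+ M) A M)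

instance : AddMonoidHomClass (Coinduced A M) A M :=
  inferInstanceAs (AddMonoidHomClass (A →+ M) A M)

@[ext] theorem ext {φ ψ : Coinduced A M} (h : ∀ x, φ x = ψ x) : φ = ψ := DFunLike.ext _ _ h

@[simp] theorem add_apply (φ ψ : Coinduced A M) (x : A) : (φ + ψ) x = φ x + ψ x := rfl

@[simp] theorem zero_apply (x : A) : (0 : Coinduced A M) x = 0 := rfl

/-- The evaluation at an element of `A`. -/
def evalHom (x : A) : Coinduced A M →+ M := AddMonoidHom.eval (M := A) (N := M) x

instance : SMul A (Coinduced A M) :=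
  ⟨fun a φ => (AddMonoidHom.comp (φ : A →+ M) (AddMonoidHom.mulRight a) : A →+ M)⟩

@[simp] theorem smul_apply (a : A) (φ : Coinduced A M) (x : A) : (a • φ) x = φ (x * a) := rfl

instance : Module A (Coinduced A M) where
  one_smul φ := by ext x; simp
  mul_smul a b φ := by ext x; simp [mul_assoc]
  smul_zero a := by ext x; simp
  smul_add a φ ψ := by ext x; simp
  add_smul a b φ := by ext x; simp [mul_add]
  zero_smul φ := by ext x; simp

theorem ext_homogeneous {φ ψ : Coinduced A M} (h : ∀ i, ∀ x ∈ 𝒜 i, φ x = ψ x) : φ = ψ := by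
  ext x
  induction x using homogeneous_induction 𝒜 with
  | zero => simp
  | add x y hx hy => simp [hx, hy]
  | homogeneous i x hx => exact h i x hx

variable (M)

/-- The additive maps that vanish on some `A_{≥ n}`. -/
def negligible : Submodule A (Coinduced A M) where
  carrier := {φ | ∃ n, ∀ x ∈ idealGE 𝒜 n, φ x = 0}
  zero_mem' := ⟨0, fun _ _ => rfl⟩
  add_mem' := by
    rintro φ ψ ⟨m, hm⟩ ⟨n, hn⟩
    refine ⟨max m n, fun x hx => ?_⟩
    rw [add_apply, hm x (idealGE_anti 𝒜 (le_max_left m n) hx),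
      hn x (idealGE_anti 𝒜 (le_max_right m n) hx), add_zero]
  smul_mem' := by
    rintro c φ ⟨n, hn⟩
    exact ⟨n, fun x hx => hn _ (mul_mem_idealGE_of_left 𝒜 hx c)⟩

variable [Module A M]

/-- The additive maps that are `A`-linear on some `A_{≥ n}`. -/
def germs : Submodule A (Coinduced A M) where
  carrier := {φ | ∃ n, ∀ x ∈ idealGE 𝒜 n, ∀ a : A, φ (a * x) = a • φ x}
  zero_mem' := ⟨0, fun _ _ _ => by simp⟩
  add_mem' := by
    rintro φ ψ ⟨m, hm⟩ ⟨n, hn⟩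
    refine ⟨max m n, fun x hx a => ?_⟩
    rw [add_apply, add_apply, hm x (idealGE_anti 𝒜 (le_max_left m n) hx),
      hn x (idealGE_anti 𝒜 (le_max_right m n) hx), smul_add]
  smul_mem' := by
    rintro c φ ⟨n, hn⟩
    exact ⟨n, fun x hx a => by
      rw [smul_apply, smul_apply, mul_assoc, hn _ (mul_mem_idealGE_of_left 𝒜 hx c)]⟩

/-- The filtered colimit of the modules of linear maps `A_{≥ n} → M`. -/
abbrev Germ : Type u := germs 𝒜 M ⧸ (negligible 𝒜 M).comap (germs 𝒜 M).subtype

variable {M}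

/-- The germ of the right multiplication by an element of `M`. -/
def ofElement : M →ₗ[A] Germ 𝒜 M :=
  Submodule.mkQ _ ∘ₗ LinearMap.codRestrict (germs 𝒜 M)
    { toFun := fun m => ((LinearMap.toSpanSingleton A M m).toAddMonoidHom : A →+ M)
      map_add' := fun m m' => by ext x; exact smul_add _ _ _
      map_smul' := fun a m => by ext x; exact smul_smul _ _ _ }
    (fun m => ⟨0, fun x _ a => mul_smul a x m⟩)

theorem mk_eq_zero {φ : germs 𝒜 M} :
    (Submodule.Quotient.mk φ : Germ 𝒜 M) = 0 ↔ ∃ n, ∀ x ∈ idealGE 𝒜 n, φ.1 x = 0 :=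
  Submodule.Quotient.mk_eq_zero _

theorem mk_eq_ofElement {φ : germs 𝒜 M} {m : M} {n : ℕ} (h : ∀ x ∈ idealGE 𝒜 n, φ.1 x = x • m) :
    (Submodule.Quotient.mk φ : Germ 𝒜 M) = ofElement 𝒜 m := by
  rw [← sub_eq_zero]
  refine (mk_eq_zero 𝒜 (φ := φ - _)).2 ⟨n, fun x hx => ?_⟩
  exact sub_eq_zero.2 (h x hx)

theorem ofElement_eq_zero {m : M} : ofElement 𝒜 m = 0 ↔ m ∈ boundedTorsion 𝒜 M :=
  Submodule.Quotient.mk_eq_zero _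

/-- If `φ` is linear on `A_{≥ n}` and `a ∈ A_{≥ n}`, then `(a • φ) x = φ (x * a) = x • φ a`, so `a •
φ` is the germ of `φ a`. Hence `ofElement` has torsion cokernel. -/
theorem exists_smul_eq_ofElement (g : Germ 𝒜 M) :
    ∃ n, ∀ a ∈ idealGE 𝒜 n, a • g ∈ LinearMap.range (ofElement 𝒜 (M := M)) := by
  obtain ⟨φ, rfl⟩ := Submodule.Quotient.mk_surjective _ g
  obtain ⟨n, hn⟩ := φ.2
  refine ⟨n, fun a ha => ⟨φ.1 a, (mk_eq_ofElement 𝒜 (φ := a • φ) (n := 0) fun x _ => ?_).symm⟩⟩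
  exact hn a ha x

theorem torsionFree_germ (ht : boundedTorsion 𝒜 M = ⊥) :
    boundedTorsion 𝒜 (Germ 𝒜 M) = ⊥ := by
  rw [eq_bot_iff]
  rintro g ⟨m, hm⟩
  obtain ⟨φ, rfl⟩ := Submodule.Quotient.mk_surjective _ g
  obtain ⟨n, hn⟩ := φ.2
  refine (mk_eq_zero 𝒜).2 ⟨max m n, fun a ha => ?_⟩
  obtain ⟨k, hk⟩ := (mk_eq_zero 𝒜 (φ := a • φ)).1 (hm a (idealGE_anti 𝒜 (le_max_left m n) ha))
  have : φ.1 a ∈ boundedTorsion 𝒜 M := ⟨k, fun x hx => by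
    rw [← hn a (idealGE_anti 𝒜 (le_max_right m n) ha) x]
    exact hk x hx⟩
  rwa [ht] at this

/-- The projection of `A` onto `A_{≥ n}`. -/
noncomputable def truncation (n : ℕ) : A →+ A :=
  (DirectSum.toAddMonoid fun i => if n ≤ i then (𝒜 i).subtype else 0).comp
    (DirectSum.decomposeAddEquiv 𝒜).toAddMonoidHom

theorem truncation_of_mem {n i : ℕ} {a : A} (ha : a ∈ 𝒜 i) :
    truncation 𝒜 n a = if n ≤ i then a else 0 := by
  change DirectSum.toAddMonoid _ (DirectSum.decompose 𝒜 a) = _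
  rw [DirectSum.decompose_of_mem 𝒜 ha, DirectSum.toAddMonoid_of]
  split <;> rfl

theorem truncation_mem (n : ℕ) (a : A) : truncation 𝒜 n a ∈ idealGE 𝒜 n := by
  induction a using homogeneous_induction 𝒜 with
  | zero => rw [map_zero]; exact zero_mem _
  | add a b ha hb => rw [map_add]; exact add_mem ha hb
  | homogeneous i a ha =>
    rw [truncation_of_mem 𝒜 ha]
    split
    · exact mem_idealGE_of_mem 𝒜 ‹_› ha
    · exact zero_mem _

theorem truncation_eq {n : ℕ} {a : A} (ha : a ∈ idealGE 𝒜 n) : truncation 𝒜 n a = a := by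
  induction ha using idealGE_induction with
  | zero => exact map_zero _
  | add a b _ _ ha hb => rw [map_add, ha, hb]
  | homogeneous i hi a ha => rw [truncation_of_mem 𝒜 ha, if_pos hi]

/-- `A_{≥ n}` is an additive direct summand of `A`, so a linear map on it extends by zero to an
additive map. This is why germs can be modelled by additive maps on all of `A`. -/
theorem exists_smul_eq_of_linearMap {n : ℕ} (φ : idealGE 𝒜 n →ₗ[A] M) :
    ∃ g : Germ 𝒜 M, ∀ a : idealGE 𝒜 n, (a : A) • g = ofElement 𝒜 (φ a) := by
  let ψ : Coinduced A M :=
    (φ.toAddMonoidHom.comp ((truncation 𝒜 n).codRestrict (idealGE 𝒜 n) (truncation_mem 𝒜 n)) :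
      A →+ M)
  have hψ : ∀ a : idealGE 𝒜 n, ψ a = φ a := fun a =>
    congrArg φ (Subtype.ext (truncation_eq 𝒜 a.2))
  have hmul : ∀ (a : idealGE 𝒜 n) (x : A), ψ (x * a) = x • φ a := fun a x => by
    rw [← map_smul, ← hψ]
    rfl
  refine ⟨Submodule.Quotient.mk ⟨ψ, n, fun x hx a => ?_⟩, fun a => ?_⟩
  · rw [hmul ⟨x, hx⟩, ← hψ]
  · exact mk_eq_ofElement 𝒜 (φ := a.1 • ⟨ψ, _⟩) (n := 0) fun x _ => hmul a x

theorem isClosedModule_germ (hfg : ∀ᶠ n in Filter.atTop, (idealGE 𝒜 n).FG)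
    (ht : boundedTorsion 𝒜 M = ⊥) : IsClosedModule 𝒜 (Germ 𝒜 M) := by
  refine IsClosedModule.of_torsionFree 𝒜 (torsionFree_germ 𝒜 ht) fun φ => ?_
  have hinj : Function.Injective (ofElement 𝒜 (M := M)) := by
    rw [injective_iff_map_eq_zero]
    intro m hm
    have := (ofElement_eq_zero 𝒜).1 hm
    rwa [ht] at this
  let R := LinearMap.range (ofElement 𝒜 (M := M))
  -- `J` consists of the `a ∈ A_{≥ 1}` with `φ a` in the image of `M`. Each `φ a` is carried there
  -- by some `A_{≥ k}`, so `A ⧸ J` is torsion and `J` contains some `A_{≥ n}`; on it `φ` takes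
  -- values in `M` and defines a germ.
  let J : Ideal A := ((R.comap φ)).map (idealGE 𝒜 1).subtype
  obtain ⟨n, hn⟩ : (Submodule.Quotient.mk 1 : A ⧸ J) ∈ boundedTorsion 𝒜 (A ⧸ J) := by
    refine mem_boundedTorsion_of_forall 𝒜 hfg (n := 1) fun a ha => ?_
    obtain ⟨k, hk⟩ := exists_smul_eq_ofElement 𝒜 (φ ⟨a, ha⟩)
    refine ⟨k, fun b hb => ?_⟩
    rw [← Submodule.Quotient.mk_smul, ← Submodule.Quotient.mk_smul, Submodule.Quotient.mk_eq_zero]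
    refine ⟨b • ⟨a, ha⟩, ?_, by simp⟩
    change φ (b • ⟨a, ha⟩) ∈ R
    rw [map_smul]
    exact hk b hb
  have hJ : ∀ a ∈ idealGE 𝒜 n, ∃ h : a ∈ idealGE 𝒜 1, φ ⟨a, h⟩ ∈ R := by
    intro a ha
    have := hn a ha
    rw [← Submodule.Quotient.mk_smul, Submodule.Quotient.mk_eq_zero, smul_eq_mul, mul_one] at this
    obtain ⟨b, hb, rfl⟩ := this
    exact ⟨b.2, hb⟩
  choose h1 h2 using hJ
  obtain ⟨g, hg⟩ := exists_smul_eq_of_linearMap 𝒜 (n := n)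
    ((LinearEquiv.ofInjective _ hinj).symm.toLinearMap ∘ₗ
      (φ ∘ₗ Submodule.inclusion h1).codRestrict R fun a => h2 a a.2)
  have hg' : ∀ (a : A) (ha : a ∈ idealGE 𝒜 n), a • g = φ ⟨a, h1 a ha⟩ := by
    intro a ha
    refine (hg ⟨a, ha⟩).trans ?_
    exact congrArg Subtype.val ((LinearEquiv.ofInjective _ hinj).apply_symm_apply
      ⟨φ ⟨a, h1 a ha⟩, h2 a ha⟩)
  refine ⟨g, fun a => eq_of_forall_smul_eq 𝒜 (torsionFree_germ 𝒜 ht) (n := n) fun b hb => ?_⟩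
  rw [smul_smul, hg' _ (mul_mem_idealGE_of_left 𝒜 hb a), ← map_smul]
  rfl

end Coinduced

end Coinduced

/-! ### The grading on germs -/

namespace GrMod

variable {A : Type u} [Ring A] {𝒜 : ℕ → AddSubgroup A} [GradedRing 𝒜] (M : GrMod 𝒜)

/-- The component of degree `k` of an additive map `A → M`, as a plain function. -/
noncomputable def degreePartFun (k : ℤ) (φ : Coinduced A M) : Coinduced A M :=
  ((DirectSum.toAddMonoid fun i : ℕ => (M.proj (i + k)).comp
    ((φ : A →+ M).comp (𝒜 i).subtype)).comp (DirectSum.decomposeAddEquiv 𝒜).toAddMonoidHom :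
      A →+ M)

theorem degreePartFun_apply (k : ℤ) (φ : Coinduced A M) {i : ℕ} {x : A} (hx : x ∈ 𝒜 i) :
    M.degreePartFun k φ x = M.proj (i + k) (φ x) := by
  change DirectSum.toAddMonoid _ (DirectSum.decompose 𝒜 x) = _
  rw [DirectSum.decompose_of_mem 𝒜 hx, DirectSum.toAddMonoid_of]
  rfl

/-- The component of degree `k` of an additive map `A → M`. -/
noncomputable def degreePart (k : ℤ) : Coinduced A M →+ Coinduced A M where
  toFun := M.degreePartFun k
  map_zero' := Coinduced.ext_homogeneous 𝒜 fun i x hx => by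
    rw [degreePartFun_apply _ _ _ hx, Coinduced.zero_apply, map_zero]
  map_add' φ ψ := Coinduced.ext_homogeneous 𝒜 fun i x hx => by
    rw [Coinduced.add_apply, degreePartFun_apply _ _ _ hx, degreePartFun_apply _ _ _ hx,
      degreePartFun_apply _ _ _ hx, Coinduced.add_apply, map_add]

theorem degreePart_apply (k : ℤ) (φ : Coinduced A M) {i : ℕ} {x : A} (hx : x ∈ 𝒜 i) :
    M.degreePart k φ x = M.proj (i + k) (φ x) :=
  M.degreePartFun_apply k φ hx

theorem degreePart_same (k : ℤ) (φ : Coinduced A M) :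
    M.degreePart k (M.degreePart k φ) = M.degreePart k φ := by
  refine Coinduced.ext_homogeneous 𝒜 fun i x hx => ?_
  rw [M.degreePart_apply _ _ hx, M.degreePart_apply _ _ hx, M.proj_same _ _ (M.proj_mem _ _)]

theorem degreePart_ne {k l : ℤ} (h : k ≠ l) (φ : Coinduced A M) :
    M.degreePart l (M.degreePart k φ) = 0 := by
  refine Coinduced.ext_homogeneous 𝒜 fun i x hx => ?_
  rw [M.degreePart_apply _ _ hx, M.degreePart_apply _ _ hx,
    M.proj_ne (i + k) _ (by omega) _ (M.proj_mem _ _), Coinduced.zero_apply]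

theorem degreePart_smul {i : ℕ} {a : A} (ha : a ∈ 𝒜 i) (k : ℤ) (φ : Coinduced A M) :
    M.degreePart (i + k) (a • φ) = a • M.degreePart k φ := by
  refine Coinduced.ext_homogeneous 𝒜 fun j x hx => ?_
  rw [M.degreePart_apply _ _ hx, Coinduced.smul_apply, Coinduced.smul_apply,
    M.degreePart_apply _ _ (SetLike.mul_mem_graded hx ha)]
  congr 2
  push_cast
  ring

theorem degreePart_apply_mul {n : ℕ} {φ : Coinduced A M}
    (hφ : ∀ x ∈ idealGE 𝒜 n, ∀ a : A, φ (a * x) = a • φ x) (k : ℤ) :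
    ∀ x ∈ idealGE 𝒜 n, ∀ a : A, M.degreePart k φ (a * x) = a • M.degreePart k φ x := by
  intro x hx a
  induction hx using idealGE_induction with
  | zero => simp
  | add x y _ _ hx hy => simp only [mul_add, map_add, smul_add, hx, hy]
  | homogeneous i hi x hx =>
    induction a using homogeneous_induction 𝒜 with
    | zero => simp
    | add a b ha hb => simp only [add_mul, map_add, add_smul, ha, hb]
    | homogeneous j a ha =>
      rw [M.degreePart_apply _ _ hx, M.degreePart_apply _ _ (SetLike.mul_mem_graded ha hx),
        hφ x (mem_idealGE_of_mem 𝒜 hi hx), ← M.proj_smul ha]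
      congr 2
      push_cast
      ring

theorem degreePart_eq_zero {n : ℕ} {φ : Coinduced A M} (hφ : ∀ x ∈ idealGE 𝒜 n, φ x = 0) (k : ℤ) :
    ∀ x ∈ idealGE 𝒜 n, M.degreePart k φ x = 0 := by
  intro x hx
  induction hx using idealGE_induction with
  | zero => simp
  | add x y _ _ hx hy => rw [map_add, hx, hy, add_zero]
  | homogeneous i hi x hx =>
    rw [M.degreePart_apply _ _ hx, hφ x (mem_idealGE_of_mem 𝒜 hi hx), map_zero]

/-- The finite set of degrees depends on `x`; an additive map may have infinitely many nonzero
components. -/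
theorem exists_sum_degreePart (φ : Coinduced A M) (x : A) :
    ∃ s : Finset ℤ, ∀ t, s ⊆ t → ∑ k ∈ t, M.degreePart k φ x = φ x := by
  classical
  induction x using homogeneous_induction 𝒜 with
  | zero => exact ⟨∅, fun t _ => by simp⟩
  | add x y hx hy =>
    obtain ⟨s, hs⟩ := hx
    obtain ⟨s', hs'⟩ := hy
    refine ⟨s ∪ s', fun t ht => ?_⟩
    simp only [map_add, Finset.sum_add_distrib]
    rw [hs t (Finset.union_subset_left ht), hs' t (Finset.union_subset_right ht)]
  | homogeneous i x hx =>
    refine ⟨(M.finite_support (φ x)).toFinset.image fun l => l - i, fun t ht => ?_⟩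
    simp only [M.degreePart_apply _ _ hx]
    have e := M.sum_proj_of_subset (φ x) (s := t.image fun k => (i : ℤ) + k) fun n hn => by
      refine Finset.mem_image.2 ⟨n - i, ht (Finset.mem_image_of_mem _ ?_), by ring⟩
      exact (M.finite_support (φ x)).mem_toFinset.2 hn
    rwa [Finset.sum_image fun _ _ _ _ h => by simpa using h] at e

/-- The component of degree `k` of a germ. -/
noncomputable def germProj (k : ℤ) : Coinduced.Germ 𝒜 M →+ Coinduced.Germ 𝒜 M :=
  QuotientAddGroup.map _ _
    (((M.degreePart k).comp (Coinduced.germs 𝒜 M).subtype.toAddMonoidHom).codRestrict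
      (Coinduced.germs 𝒜 M) fun φ => by
        obtain ⟨n, hn⟩ := φ.2
        exact ⟨n, M.degreePart_apply_mul hn k⟩)
    (by
      rintro φ ⟨n, hn⟩
      exact ⟨n, M.degreePart_eq_zero hn k⟩)

/-- The graded module of germs of linear maps `A_{≥ n} → M`. -/
noncomputable def germ (hfg : ∀ᶠ n in Filter.atTop, (idealGE 𝒜 n).FG) : GrMod 𝒜 where
  carrier := Coinduced.Germ 𝒜 M
  gr k := (M.germProj k).range
  isInternal := by
    refine isInternal_of_proj _ M.germProj ?_ ?_ ?_
    · rintro k _ ⟨g, rfl⟩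
      obtain ⟨φ, rfl⟩ := Submodule.Quotient.mk_surjective _ g
      exact congrArg Submodule.Quotient.mk (Subtype.ext (M.degreePart_same k φ.1))
    · rintro k l h _ ⟨g, rfl⟩
      obtain ⟨φ, rfl⟩ := Submodule.Quotient.mk_surjective _ g
      exact (congrArg Submodule.Quotient.mk (Subtype.ext (M.degreePart_ne h φ.1))).trans
        (Submodule.Quotient.mk_zero _)
    · intro g
      classical
      obtain ⟨φ, rfl⟩ := Submodule.Quotient.mk_surjective _ g
      obtain ⟨n, hn⟩ := φ.2
      obtain ⟨m, ⟨s, hs⟩, hm⟩ := (hfg.and (Filter.eventually_ge_atTop n)).exists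
      choose t ht using M.exists_sum_degreePart φ.1
      -- On `A_{≥ m}` both sides are linear, so the degrees needed for finitely many generators
      -- suffice for all `x`. Finite generation is what makes a germ a finite sum of components.
      have key : ∀ x ∈ idealGE 𝒜 m, ∑ k ∈ s.biUnion t, M.degreePart k φ.1 x = φ.1 x := by
        intro x hx
        rw [← hs] at hx
        obtain ⟨f, -, rfl⟩ := Submodule.mem_span_finset.1 hx
        have hsm : ∀ y ∈ s, y ∈ idealGE 𝒜 n := fun y hy =>
          idealGE_anti 𝒜 hm (hs ▸ Submodule.subset_span hy)
        simp only [map_sum, smul_eq_mul]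
        rw [Finset.sum_comm]
        refine Finset.sum_congr rfl fun y hy => ?_
        rw [hn y (hsm y hy), ← ht y _ (Finset.subset_biUnion_of_mem t hy), Finset.smul_sum]
        exact Finset.sum_congr rfl fun k _ => M.degreePart_apply_mul hn k y (hsm y hy) _
      have : (Submodule.Quotient.mk φ : Coinduced.Germ 𝒜 M) =
          ∑ k ∈ s.biUnion t, M.germProj k (Submodule.Quotient.mk φ) := by
        let d : ℤ → Coinduced.germs 𝒜 M := fun k =>
          ⟨M.degreePart k φ.1, n, M.degreePart_apply_mul hn k⟩
        have e : Submodule.mkQ _ (φ - ∑ k ∈ s.biUnion t, d k) = (0 : Coinduced.Germ 𝒜 M) := by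
          refine (Coinduced.mk_eq_zero 𝒜).2 ⟨m, fun x hx => ?_⟩
          refine (map_sub ((Coinduced.evalHom x).comp
            (Coinduced.germs 𝒜 M).subtype.toAddMonoidHom) _ _).trans ?_
          rw [map_sum]
          exact sub_eq_zero.2 (key x hx).symm
        rw [map_sub, map_sum, sub_eq_zero] at e
        exact e
      rw [this]
      exact sum_mem fun k _ => AddSubgroup.mem_iSup_of_mem k ⟨_, rfl⟩
  smul_mem := by
    rintro i k a _ ha ⟨g, rfl⟩
    obtain ⟨φ, rfl⟩ := Submodule.Quotient.mk_surjective _ g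
    exact ⟨a • Submodule.Quotient.mk φ,
      congrArg Submodule.Quotient.mk (Subtype.ext (M.degreePart_smul ha k φ.1))⟩

/-- The canonical morphism from a graded module to its module of germs. -/
noncomputable def toGerm (hfg : ∀ᶠ n in Filter.atTop, (idealGE 𝒜 n).FG) : M ⟶ M.germ hfg :=
  (⟨Coinduced.ofElement 𝒜, fun k x hx => ⟨Coinduced.ofElement 𝒜 x,
    congrArg Submodule.Quotient.mk (Subtype.ext (Coinduced.ext_homogeneous 𝒜 fun i a ha =>
      (M.degreePart_apply k _ ha).trans (M.proj_same _ _ (M.smul_mem i k a x ha hx))))⟩⟩ :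
    Hom M (M.germ hfg))

/-- The underlying module is closed. -/
def closed (𝒜 : ℕ → AddSubgroup A) [GradedRing 𝒜] : ObjectProperty (GrMod 𝒜) :=
  fun N => IsClosedModule 𝒜 N

/-- The map is `M → M/t(M) → germs of M/t(M)`. Dividing by `t(M)` first is needed, as germs are
shown to be closed over torsion-free modules. -/
theorem exists_isoModSerre_closed [(virtuallyFinitelyGraded 𝒜).IsSerreClass]
    (hfg : ∀ᶠ n in Filter.atTop, (idealGE 𝒜 n).FG) :
    ∃ (N : GrMod 𝒜) (f : M ⟶ N), closed 𝒜 N ∧ (virtuallyFinitelyGraded 𝒜).isoModSerre f := by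
  have ht := boundedTorsion_quotient_eq_bot 𝒜 (M := M) hfg
  refine ⟨(M.quotient _ M.boundedTorsion_isHomogeneous).germ hfg,
    M.quotπ _ M.boundedTorsion_isHomogeneous ≫ toGerm _ hfg,
    Coinduced.isClosedModule_germ 𝒜 hfg ht,
    (virtuallyFinitelyGraded 𝒜).isoModSerre.comp_mem _ _ ((isoModSerre_iff _).2 ⟨?_, ?_⟩)
      ((isoModSerre_iff _).2 ⟨?_, ?_⟩)⟩
  · exact fun x hx => (Submodule.Quotient.mk_eq_zero _).1 hx
  · intro y
    obtain ⟨x, rfl⟩ := Submodule.mkQ_surjective _ y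
    exact ⟨0, fun a _ => ⟨a • x, rfl⟩⟩
  · exact fun x hx => (Coinduced.ofElement_eq_zero 𝒜).1 hx
  · exact fun y => Coinduced.exists_smul_eq_ofElement 𝒜 y

end GrMod

/-! ### Colimits and local finite presentability of `A-Gr` -/

namespace GrMod

section

variable {A : Type u} [Ring A] {𝒜 : ℕ → AddSubgroup A}

theorem smul_mem_of_mem_ringGr (M : GrMod 𝒜) {k d : ℤ} {a : A} (ha : a ∈ ringGr 𝒜 k) {x : M}
    (hx : x ∈ M.gr d) : a • x ∈ M.gr (k + d) := by
  rcases k with k | k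
  · exact M.smul_mem k d a x ha hx
  · obtain rfl : a = 0 := ha
    rw [zero_smul]
    exact zero_mem _

section Coproduct

variable {J : Type u} [DecidableEq J] (X : J → GrMod 𝒜)

/-- The direct sum of a family of graded modules. -/
def sigma : GrMod 𝒜 where
  carrier := ⨁ j, X j
  gr n :=
    { carrier := {x | ∀ j, x j ∈ (X j).gr n}
      zero_mem' := fun j => zero_mem _
      add_mem' := fun hx hy j => add_mem (hx j) (hy j)
      neg_mem' := fun hx j => neg_mem (hx j) }
  isInternal := by
    refine isInternal_of_proj _ (fun n => DirectSum.map fun j => (X j).proj n) ?_ ?_ ?_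
    · intro n x hx
      refine DFinsupp.ext fun j => ?_
      rw [DirectSum.map_apply]
      exact (X j).proj_same n _ (hx j)
    · intro m n h x hx
      refine DFinsupp.ext fun j => ?_
      rw [DirectSum.map_apply]
      exact (X j).proj_ne m n h _ (hx j)
    · intro x
      induction x using DirectSum.induction_on with
      | zero => exact zero_mem _
      | add x y hx hy => exact add_mem hx hy
      | of j x =>
        obtain ⟨s, hs⟩ := (X j).sum_proj x
        rw [← hs, map_sum]
        refine sum_mem fun n _ => AddSubgroup.mem_iSup_of_mem n fun k => ?_
        by_cases h : k = j
        · subst h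
          rw [DirectSum.of_eq_same]
          exact (X k).proj_mem n x
        · rw [DirectSum.of_eq_of_ne _ _ _ h]
          exact zero_mem _
  smul_mem i k a x ha hx j := by
    rw [DirectSum.smul_apply]
    exact (X j).smul_mem i k a _ ha (hx j)

theorem lof_mem_gr {j : J} {n : ℤ} {x : X j} (hx : x ∈ (X j).gr n) :
    DirectSum.lof A J (fun j => X j) j x ∈ (sigma X).gr n := by
  intro k
  change (DirectSum.of (fun j => X j) j x) k ∈ _
  by_cases h : k = j
  · subst h
    rw [DirectSum.of_eq_same]
    exact hx
  · rw [DirectSum.of_eq_of_ne _ _ _ h]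
    exact zero_mem _

/-- The inclusion of a summand. -/
def sigmaι (j : J) : X j ⟶ sigma X :=
  (⟨DirectSum.lof A J (fun j => X j) j, fun _ _ hx => lof_mem_gr X hx⟩ : Hom (X j) (sigma X))

theorem toModule_mem_gr {Y : GrMod 𝒜} (f : ∀ j, X j ⟶ Y) {n : ℤ} (x : ⨁ j, X j)
    (hx : ∀ j, x j ∈ (X j).gr n) : DirectSum.toModule A J Y (fun j => lin (f j)) x ∈ Y.gr n := by
  classical
  rw [← DirectSum.sum_support_of x, map_sum]
  refine sum_mem fun j _ => ?_
  rw [← DirectSum.lof_eq_of A, DirectSum.toModule_lof]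
  exact lin_mem (f j) n _ (hx j)

/-- The morphism out of a direct sum given by a family of morphisms. -/
def sigmaDesc {Y : GrMod 𝒜} (f : ∀ j, X j ⟶ Y) : sigma X ⟶ Y :=
  (⟨DirectSum.toModule A J Y fun j => lin (f j), fun _ x hx => toModule_mem_gr X f x hx⟩ :
    Hom (sigma X) Y)

theorem lin_sigmaDesc_lof {Y : GrMod 𝒜} (f : ∀ j, X j ⟶ Y) (j : J) (x : X j) :
    lin (sigmaDesc X f) (DirectSum.lof A J (fun j => X j) j x) = lin (f j) x :=
  DirectSum.toModule_lof (M := fun j => X j) A j x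

/-- The direct sum is a coproduct. -/
def isColimitSigma : IsColimit (Cofan.mk (sigma X) (sigmaι X)) :=
  Cofan.IsColimit.mk _ (fun s => sigmaDesc X s.inj)
    (fun s j => hom_ext fun x => lin_sigmaDesc_lof X s.inj j x)
    (fun s m h => lin_injective (DirectSum.linearMap_ext _ fun j => by
      ext x
      exact (congrArg (fun k => lin k x) (h j)).trans (lin_sigmaDesc_lof X s.inj j x).symm))

end Coproduct

noncomputable instance : HasCoproducts.{u} (GrMod 𝒜) := by
  classical
  exact hasCoproducts_of_colimit_cofans _ isColimitSigma

noncomputable instance : HasColimitsOfSize.{u, u} (GrMod 𝒜) :=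
  has_colimits_of_hasCoequalizers_and_coproducts

variable (𝒜) in
/-- The functor that forgets the grading. -/
def forgetGrading : GrMod 𝒜 ⥤ ModuleCat.{u} A where
  obj M := ModuleCat.of A M
  map f := ModuleCat.ofHom (lin f)

instance : (forgetGrading 𝒜).Additive where

noncomputable instance : PreservesFiniteColimits (forgetGrading 𝒜) := by
  have h : (∀ S : ShortComplex (GrMod 𝒜), S.ShortExact →
      (S.map (forgetGrading 𝒜)).Exact ∧ Epi ((forgetGrading 𝒜).map S.g)) ↔
      PreservesFiniteColimits (forgetGrading 𝒜) :=
    (forgetGrading 𝒜).preservesFiniteColimits_tfae.out 0 3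
  refine h.1 fun S hS => ⟨?_, ?_⟩
  · rw [ShortComplex.moduleCat_exact_iff]
    exact fun x hx => exists_lin_eq_of_shortExact hS hx
  · rw [ModuleCat.epi_iff_surjective]
    have := hS.epi_g
    exact surjective_of_epi S.g

/-- Allows filtered colimits of graded modules to be handled through elements. -/
noncomputable instance : PreservesColimitsOfSize.{u, u} (forgetGrading 𝒜) := by
  classical
  have (J : Type u) : PreservesColimitsOfShape (Discrete J) (forgetGrading 𝒜) := by
    have (X : J → GrMod 𝒜) : PreservesColimit (Discrete.functor X) (forgetGrading 𝒜) :=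
      preservesColimit_of_preserves_colimit_cocone (isColimitSigma X)
        ((isColimitMapCoconeCofanMkEquiv _ _ _).2
          (ModuleCat.coproductCoconeIsColimit fun j => (forgetGrading 𝒜).obj (X j)))
    exact preservesColimitsOfShape_of_discrete _
  exact preservesColimits_of_preservesCoequalizers_and_coproducts _

section Filtered

variable {J : Type u} [SmallCategory J] [IsFiltered J] {F : J ⥤ GrMod 𝒜} {c : Cocone F}

theorem exists_lin_ι_eq (hc : IsColimit c) (x : c.pt) :
    ∃ j, ∃ y : F.obj j, lin (c.ι.app j) y = x := by
  obtain ⟨j, y, h⟩ := Concrete.isColimit_exists_rep (F ⋙ forgetGrading 𝒜)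
    (isColimitOfPreserves (forgetGrading 𝒜) hc) x
  exact ⟨j, y, h⟩

theorem exists_lin_map_eq (hc : IsColimit c) {j : J} {x y : F.obj j}
    (h : lin (c.ι.app j) x = lin (c.ι.app j) y) :
    ∃ k, ∃ f : j ⟶ k, lin (F.map f) x = lin (F.map f) y := by
  obtain ⟨k, f, g, e⟩ := Concrete.isColimit_exists_of_rep_eq (F ⋙ forgetGrading 𝒜)
    (isColimitOfPreserves (forgetGrading 𝒜) hc) (i := j) (j := j) x y h
  refine ⟨IsFiltered.coeq f g, f ≫ IsFiltered.coeqHom f g, ?_⟩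
  have e' : lin (F.map f) x = lin (F.map g) y := e
  conv_rhs => rw [IsFiltered.coeq_condition]
  rw [F.map_comp, F.map_comp, lin_comp, lin_comp, e']

end Filtered

end

variable {A : Type u} [Ring A] (𝒜 : ℕ → AddSubgroup A) [GradedRing 𝒜]

/-- The graded module `M` with its degrees raised by `d`. -/
def shift {𝒜 : ℕ → AddSubgroup A} (M : GrMod 𝒜) (d : ℤ) : GrMod 𝒜 where
  carrier := M
  gr n := M.gr (n - d)
  isInternal := isInternal_of_proj _ (fun n => M.proj (n - d)) (fun n => M.proj_same _)
    (fun m n h => M.proj_ne _ _ (by omega)) fun x => by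
      obtain ⟨s, hs⟩ := M.sum_proj x
      rw [← hs]
      refine sum_mem fun n _ => AddSubgroup.mem_iSup_of_mem (n + d) ?_
      rw [add_sub_cancel_right]
      exact M.proj_mem n x
  smul_mem i j a x ha hx := by
    rw [add_sub_assoc]
    exact M.smul_mem i _ a x ha hx

/-- The free graded module of rank one with its generator in degree `d`. -/
def free (d : ℤ) : GrMod 𝒜 := (self 𝒜).shift d

/-- The generator of `free 𝒜 d`. -/
def gen (d : ℤ) : free 𝒜 d := (1 : A)

variable {𝒜}

theorem gen_mem (d : ℤ) : gen 𝒜 d ∈ (free 𝒜 d).gr d := by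
  change (1 : A) ∈ ringGr 𝒜 (d - d)
  rw [sub_self]
  exact SetLike.GradedOne.one_mem (A := 𝒜)

/-- The morphism `free 𝒜 d ⟶ M` given by an element of degree `d`. -/
def freeDesc (M : GrMod 𝒜) {d : ℤ} (x : M) (hx : x ∈ M.gr d) : free 𝒜 d ⟶ M :=
  (⟨LinearMap.toSpanSingleton A M x, fun n a ha => by
    have := M.smul_mem_of_mem_ringGr (k := n - d) ha hx
    rwa [sub_add_cancel] at this⟩ : Hom (free 𝒜 d) M)

theorem lin_freeDesc_gen (M : GrMod 𝒜) {d : ℤ} (x : M) (hx : x ∈ M.gr d) :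
    lin (freeDesc M x hx) (gen 𝒜 d) = x := one_smul A x

theorem free_hom_ext {M : GrMod 𝒜} {d : ℤ} {f g : free 𝒜 d ⟶ M}
    (h : lin f (gen 𝒜 d) = lin g (gen 𝒜 d)) : f = g := by
  refine hom_ext fun a => ?_
  have e : a = (show A from a) • gen 𝒜 d := (mul_one (show A from a)).symm
  rw [e, map_smul, map_smul, h]

attribute [local instance] Cardinal.fact_isRegular_aleph0

/-- Morphisms from `free 𝒜 d` to `M` are the elements of `M_d`, and `M ↦ M_d` commutes with filtered
colimits. -/
instance isFinitelyPresentable_free (d : ℤ) : IsFinitelyPresentable.{u} (free 𝒜 d) := by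
  rw [isFinitelyPresentable_iff_preservesFilteredColimitsOfSize]
  refine ⟨fun J _ _ => ⟨fun {F} => ⟨fun {c} hc => ⟨?_⟩⟩⟩⟩
  refine Types.FilteredColimit.isColimitOf' _ _ (fun f => ?_) (fun j f g h => ?_)
  · obtain ⟨j, y, hy⟩ := exists_lin_ι_eq hc (lin f (gen 𝒜 d))
    -- The representative `y` need not be homogeneous; its component of degree `d` still represents
    -- the image of the generator.
    refine ⟨j, freeDesc _ _ ((F.obj j).proj_mem d y), free_hom_ext ?_⟩
    refine Eq.trans ?_ (congrArg (lin (c.ι.app j)) (lin_freeDesc_gen _ _ _)).symm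
    rw [lin_proj, hy]
    exact (c.pt.proj_same _ _ (lin_mem f d _ (gen_mem d))).symm
  · obtain ⟨k, u, hu⟩ := exists_lin_map_eq hc (j := j) (x := lin f (gen 𝒜 d))
      (y := lin g (gen 𝒜 d)) (congrArg (fun k => lin k (gen 𝒜 d)) h)
    exact ⟨k, u, free_hom_ext hu⟩

theorem isStrongGenerator_free :
    (ObjectProperty.ofObj fun d : ULift.{u} ℤ => free 𝒜 d.down).IsStrongGenerator := by
  rw [ObjectProperty.isStrongGenerator_iff]
  refine ⟨fun X Y f g h => ?_, fun X Y i _ h => ?_⟩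
  · refine hom_ext fun x => ?_
    induction x using induction_on_homogeneous with
    | zero => simp
    | add x y hx hy => simp only [map_add, hx, hy]
    | homogeneous d x hx =>
      have := congrArg (fun k => lin k (gen 𝒜 d)) (h _ (.mk ⟨d⟩) (freeDesc X x hx))
      simpa only [lin_comp, lin_freeDesc_gen] using this
  · have hs : ∀ y, ∃ x, lin i x = y := by
      intro y
      induction y using induction_on_homogeneous with
      | zero => exact ⟨0, map_zero _⟩
      | add y z hy hz =>
        obtain ⟨y', rfl⟩ := hy
        obtain ⟨z', rfl⟩ := hz
        exact ⟨y' + z', map_add _ _ _⟩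
      | homogeneous d y hy =>
        obtain ⟨f, hf⟩ := h _ (.mk ⟨d⟩) (freeDesc Y y hy)
        exact ⟨lin f (gen 𝒜 d), (congrArg (fun k => lin k (gen 𝒜 d)) hf).trans
          (lin_freeDesc_gen Y y hy)⟩
    have : Epi i := ⟨fun g g' e => hom_ext fun y => by
      obtain ⟨x, rfl⟩ := hs y
      exact congrArg (fun k => lin k x) e⟩
    exact isIso_of_mono_of_epi i

instance : IsLocallyFinitelyPresentable.{u} (GrMod 𝒜) := by
  refine (IsCardinalLocallyPresentable.iff_exists_isStrongGenerator _ _).2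
    ⟨_, inferInstance, isStrongGenerator_free, ?_⟩
  rintro _ ⟨d⟩
  exact isFinitelyPresentable_free _

end GrMod

/-! ### Closed modules under filtered colimits, and the reflection -/

namespace GrMod

section

variable {A : Type u} [Ring A] {𝒜 : ℕ → AddSubgroup A}
  {J : Type u} [SmallCategory J] {F : J ⥤ GrMod 𝒜} {c : Cocone F}

theorem lin_ι_map (c : Cocone F) {j k : J} (f : j ⟶ k) (y : F.obj j) :
    lin (c.ι.app k) (lin (F.map f) y) = lin (c.ι.app j) y :=
  congrArg (fun g => lin g y) (c.w f)

variable [IsFiltered J]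

theorem exists_forall_lin_ι_eq (hc : IsColimit c) {ι : Type*} (s : Finset ι) (x : ι → c.pt) :
    ∃ j, ∀ i ∈ s, ∃ y : F.obj j, lin (c.ι.app j) y = x i := by
  classical
  induction s using Finset.induction_on with
  | empty => exact ⟨IsFiltered.nonempty.some, by simp⟩
  | insert i s _ ih =>
    obtain ⟨j, hj⟩ := ih
    obtain ⟨k, y, hy⟩ := exists_lin_ι_eq hc (x i)
    refine ⟨IsFiltered.max j k, fun l hl => ?_⟩
    rcases Finset.mem_insert.1 hl with rfl | hl
    · exact ⟨lin (F.map (IsFiltered.rightToMax j k)) y, by rw [lin_ι_map, hy]⟩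
    · obtain ⟨z, hz⟩ := hj l hl
      exact ⟨lin (F.map (IsFiltered.leftToMax j k)) z, by rw [lin_ι_map, hz]⟩

theorem exists_forall_lin_map_eq_zero (hc : IsColimit c) {ι : Type*} (s : Finset ι) {j : J}
    (x : ι → F.obj j) (hx : ∀ i ∈ s, lin (c.ι.app j) (x i) = 0) :
    ∃ k, ∃ f : j ⟶ k, ∀ i ∈ s, lin (F.map f) (x i) = 0 := by
  classical
  induction s using Finset.induction_on with
  | empty => exact ⟨j, 𝟙 j, by simp⟩
  | insert i s _ ih =>
    obtain ⟨k, f, hf⟩ := ih fun l hl => hx l (Finset.mem_insert_of_mem hl)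
    obtain ⟨k', f', hf'⟩ := exists_lin_map_eq hc (x := x i) (y := 0)
      (by rw [hx i (Finset.mem_insert_self i s), map_zero])
    obtain ⟨l, g, g', e⟩ := IsFiltered.span f f'
    refine ⟨l, f ≫ g, fun m hm => ?_⟩
    rcases Finset.mem_insert.1 hm with rfl | hm
    · rw [e, F.map_comp, lin_comp, hf', map_zero, map_zero]
    · rw [F.map_comp, lin_comp, hf m hm, map_zero]

end

variable {A : Type u} [Ring A] {𝒜 : ℕ → AddSubgroup A} [GradedRing 𝒜]

/-- Finite presentation makes `Hom(A_{≥ 1}, -)` commute with filtered colimits, so the bijectivity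
passes to the colimit. -/
theorem isClosedModule_of_isColimit (hfp : Module.FinitePresentation A (idealGE 𝒜 1))
    {J : Type u} [SmallCategory J] [IsFiltered J] {F : J ⥤ GrMod 𝒜} {c : Cocone F}
    (hc : IsColimit c) (hF : ∀ j, IsClosedModule 𝒜 (F.obj j)) : IsClosedModule 𝒜 c.pt := by
  obtain ⟨n, m, f, g, hf, hfg⟩ := Module.FinitePresentation.exists_fin' A (idealGE 𝒜 1)
  have hfg' : ∀ x, f (g x) = 0 := hfg.apply_apply_eq_zero
  let b := Pi.basisFun A (Fin n)
  let b' := Pi.basisFun A (Fin m)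
  refine fun φ => existsUnique_of_exists_of_unique ?_ ?_
  · obtain ⟨j, hj⟩ := exists_forall_lin_ι_eq hc Finset.univ fun i => φ (f (b i))
    choose y hy using fun i => hj i (Finset.mem_univ i)
    let h : (Fin n → A) →ₗ[A] F.obj j := b.constr ℕ y
    have hh : lin (c.ι.app j) ∘ₗ h = φ ∘ₗ f := b.ext fun i => by
      change lin (c.ι.app j) (h (b i)) = φ (f (b i))
      rw [b.constr_basis, hy]
    have hh' : ∀ x, lin (c.ι.app j) (h x) = φ (f x) := LinearMap.congr_fun hh
    -- The images of the generators have been lifted to stage `j`; the finitely many relations hold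
    -- from some stage `k` on, so `φ` factors through `F.obj k`.
    obtain ⟨k, u, hu⟩ := exists_forall_lin_map_eq_zero hc Finset.univ (fun i => h (g (b' i)))
      fun i _ => by rw [hh', hfg', map_zero]
    have hzero : lin (F.map u) ∘ₗ h ∘ₗ g = 0 := b'.ext fun i => hu i (Finset.mem_univ i)
    have hle : LinearMap.ker f ≤ LinearMap.ker (lin (F.map u) ∘ₗ h) := by
      rw [hfg.linearMap_ker_eq]
      rintro _ ⟨x, rfl⟩
      exact LinearMap.congr_fun hzero x
    obtain ⟨x, hx, -⟩ := hF k ((LinearMap.ker f).liftQ _ hle ∘ₗ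
      (f.quotKerEquivOfSurjective hf).symm.toLinearMap)
    refine ⟨lin (c.ι.app k) x, fun a => ?_⟩
    obtain ⟨z, rfl⟩ := hf a
    rw [← hh', ← lin_ι_map c u, ← map_smul, ← hx]
    refine congrArg (lin (c.ι.app k)) ?_
    have e : (f.quotKerEquivOfSurjective hf).symm (f z) = (LinearMap.ker f).mkQ z := by
      rw [LinearEquiv.symm_apply_eq]
      rfl
    exact (congrArg ((LinearMap.ker f).liftQ _ hle) e).symm
  · intro x y hx hy
    -- The difference is killed by `A_{≥ 1}`. Finitely many generators kill a representative already
    -- at some stage, where closedness forces it to be zero.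
    obtain ⟨j, z, hz⟩ := exists_lin_ι_eq hc (x - y)
    obtain ⟨k, u, hu⟩ := exists_forall_lin_map_eq_zero hc Finset.univ
      (fun i => (f (b i) : A) • z) fun i _ => by
        rw [map_smul, hz, smul_sub, ← hx, ← hy, sub_self]
    have hzero : (LinearMap.toSpanSingleton A _ (lin (F.map u) z)).domRestrict _ ∘ₗ f = 0 :=
      b.ext fun i => by
        refine Eq.trans ?_ (hu i (Finset.mem_univ i))
        rw [map_smul]
        rfl
    have h0 : lin (F.map u) z = 0 := (hF k 0).unique
      (fun a => by
        obtain ⟨w, rfl⟩ := hf a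
        exact (LinearMap.congr_fun hzero w).symm) (fun a => (smul_zero _).symm)
    rw [← sub_eq_zero, ← hz, ← lin_ι_map c u, h0, map_zero]

attribute [local instance] Cardinal.fact_isRegular_aleph0

theorem isFinitelyAccessible_closed_ι (hfp : Module.FinitePresentation A (idealGE 𝒜 1)) :
    (closed 𝒜).ι.IsCardinalAccessible Cardinal.aleph0.{u} where
  preservesColimitOfShape J _ _ := by
    have := isFiltered_of_isCardinalFiltered J Cardinal.aleph0.{u}
    have : (closed 𝒜).IsClosedUnderColimitsOfShape J :=
      ⟨fun Z ⟨p⟩ => isClosedModule_of_isColimit hfp p.isColimit p.prop_diag_obj⟩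
    infer_instance

section Reflection

variable [(virtuallyFinitelyGraded 𝒜).IsSerreClass]

theorem isRightAdjoint_closed_ι (hfg : ∀ᶠ n in Filter.atTop, (idealGE 𝒜 n).FG) :
    (closed 𝒜).ι.IsRightAdjoint := by
  rw [Functor.isRightAdjoint_iff_leftAdjointObjIsDefined_eq_top]
  ext M
  obtain ⟨N, f, hN, hf⟩ := M.exists_isoModSerre_closed hfg
  let r : ((closed 𝒜).ι ⋙ coyoneda.obj (Opposite.op M)).CorepresentableBy ⟨N, hN⟩ :=
    { homEquiv := fun {K} => (ObjectProperty.fullyFaithfulι _).homEquiv.trans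
        (Equiv.ofBijective _ (bijective_comp_of_isClosedModule K.2 f hf))
      homEquiv_comp := fun _ _ => rfl }
  simpa using! r.isCorepresentable

/-- Closed modules are local, so the reflector inverts these maps. Conversely the units have torsion
kernel and cokernel, and cancellation in the naturality square of the unit gives the other
inclusion. -/
theorem isoModSerre_eq_inverseImage (hfg : ∀ᶠ n in Filter.atTop, (idealGE 𝒜 n).FG)
    {L : GrMod 𝒜 ⥤ (closed 𝒜).FullSubcategory} (adj : L ⊣ (closed 𝒜).ι) :
    (virtuallyFinitelyGraded 𝒜).isoModSerre = (MorphismProperty.isomorphisms _).inverseImage L := by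
  have hle : (virtuallyFinitelyGraded 𝒜).isoModSerre ≤
      (MorphismProperty.isomorphisms _).inverseImage L := by
    rw [← ObjectProperty.isLocal_eq_inverseImage_isomorphisms adj]
    rintro X Y f hf _ ⟨K, rfl⟩
    exact bijective_comp_of_isClosedModule K.2 f hf
  -- Compare the unit at `M` with the explicit map `f` to a closed module: `L` inverts `f` and the
  -- unit at `N` is invertible, so the two differ by isomorphisms.
  have hunit : ∀ M, (virtuallyFinitelyGraded 𝒜).isoModSerre (adj.unit.app M) := by
    intro M
    obtain ⟨N, f, hN, hf⟩ := M.exists_isoModSerre_closed hfg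
    have : IsIso (L.map f) := hle f hf
    have : IsIso (adj.unit.app N) :=
      inferInstanceAs (IsIso (adj.unit.app ((closed 𝒜).ι.obj ⟨N, hN⟩)))
    refine (virtuallyFinitelyGraded 𝒜).isoModSerre.of_postcomp _ ((closed 𝒜).ι.map (L.map f))
      ((virtuallyFinitelyGraded 𝒜).isoModSerre_of_isIso _) ?_
    have e : f ≫ adj.unit.app N = adj.unit.app M ≫ (closed 𝒜).ι.map (L.map f) :=
      adj.unit.naturality f
    rw [← e]
    exact (virtuallyFinitelyGraded 𝒜).isoModSerre.comp_mem _ _ hf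
      ((virtuallyFinitelyGraded 𝒜).isoModSerre_of_isIso _)
  refine le_antisymm hle fun X Y f hf => ?_
  have : IsIso (L.map f) := hf
  refine (virtuallyFinitelyGraded 𝒜).isoModSerre.of_postcomp _ _ (hunit Y) ?_
  have e : f ≫ adj.unit.app Y = adj.unit.app X ≫ (closed 𝒜).ι.map (L.map f) :=
    adj.unit.naturality f
  rw [e]
  exact (virtuallyFinitelyGraded 𝒜).isoModSerre.comp_mem _ _ (hunit X)
    ((virtuallyFinitelyGraded 𝒜).isoModSerre_of_isIso _)

/-- The quotient functor has a fully faithful accessible right adjoint with closed values. -/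
theorem exists_adjunction (hfp : Module.FinitePresentation A (idealGE 𝒜 1))
    (hfg : ∀ᶠ n in Filter.atTop, (idealGE 𝒜 n).FG) {D : Type w} [Category.{v} D]
    (q : GrMod 𝒜 ⥤ D) [q.IsLocalization (virtuallyFinitelyGraded 𝒜).isoModSerre] :
    ∃ (r : D ⥤ GrMod 𝒜) (_ : q ⊣ r), r.Full ∧ r.Faithful ∧
      r.IsCardinalAccessible Cardinal.aleph0.{u} ∧ (∀ Y, IsClosedModule 𝒜 (r.obj Y)) ∧
      ∀ N : GrMod 𝒜, IsClosedModule 𝒜 N → r.essImage N := by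
  have := isRightAdjoint_closed_ι hfg
  have := isFinitelyAccessible_closed_ι hfp
  let adj := Adjunction.ofIsRightAdjoint (closed 𝒜).ι
  have : (closed 𝒜).ι.leftAdjoint.IsLocalization (virtuallyFinitelyGraded 𝒜).isoModSerre := by
    rw [isoModSerre_eq_inverseImage hfg adj]
    exact adj.isLocalization
  -- Localizations at the same morphisms are equivalent, which transports the reflection to `D`.
  let e := Localization.uniq (closed 𝒜).ι.leftAdjoint q (virtuallyFinitelyGraded 𝒜).isoModSerre
  refine ⟨e.inverse ⋙ (closed 𝒜).ι, (adj.comp e.toAdjunction).ofNatIsoLeft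
    (Localization.compUniqFunctor _ _ _), inferInstance, inferInstance, inferInstance,
    fun Y => (e.inverse.obj Y).2, fun N hN => ⟨e.functor.obj ⟨N, hN⟩,
      ⟨(closed 𝒜).ι.mapIso (e.unitIso.symm.app ⟨N, hN⟩)⟩⟩⟩

/-- The left adjoint of a fully faithful accessible functor carries finitely presented generators to
finitely presented generators. -/
theorem isLocallyFinitelyPresentable (hfp : Module.FinitePresentation A (idealGE 𝒜 1))
    (hfg : ∀ᶠ n in Filter.atTop, (idealGE 𝒜 n).FG) {D : Type w} [Category.{v} D]
    (q : GrMod 𝒜 ⥤ D) [q.IsLocalization (virtuallyFinitelyGraded 𝒜).isoModSerre] :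
    IsLocallyFinitelyPresentable.{u} D := by
  obtain ⟨r, adj, _, _, _, -⟩ := exists_adjunction hfp hfg q
  exact adj.isCardinalLocallyPresentable _

end Reflection

end GrMod

/-! ### The `Ext` condition and closed direct sums -/

section

variable {A : Type u} [Ring A] {𝒜 : ℕ → AddSubgroup A} [GradedRing 𝒜]

/-- The projection of `A` onto its component of degree zero. -/
noncomputable def toZeroComponent (𝒜 : ℕ → AddSubgroup A) [GradedRing 𝒜] :
    A →ₗ[A] zeroComponent 𝒜 where
  toFun a := (GradedRing.projZeroRingHom' 𝒜 a : 𝒜 0)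
  map_add' a b := map_add (GradedRing.projZeroRingHom' 𝒜) a b
  map_smul' a b := map_mul (GradedRing.projZeroRingHom' 𝒜) a b

theorem ker_toZeroComponent : LinearMap.ker (toZeroComponent 𝒜) = idealGE 𝒜 1 := by
  ext a
  constructor
  · intro h i hi
    obtain rfl : i = 0 := by omega
    exact congrArg Subtype.val (show (GradedRing.projZeroRingHom' 𝒜 a : 𝒜 0) = 0 from h)
  · intro h
    exact Subtype.ext (h 0 one_pos)

/-- By `0 → A_{≥ 1} → A → A_0 → 0`, the obstruction to extending `φ` to `A` lies in `Ext¹(A_0, N)`;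
the extension is determined by its value at `1`. -/
theorem exists_smul_eq_of_subsingleton_ext {N : ModuleCat.{u} A}
    (h : Subsingleton (Abelian.Ext.{u} (zeroComponent 𝒜) N 1)) (φ : idealGE 𝒜 1 →ₗ[A] N) :
    ∃ x : N, ∀ a, φ a = (a : A) • x := by
  let S : ShortComplex (ModuleCat.{u} A) :=
    ShortComplex.mk (X₁ := ModuleCat.of A (idealGE 𝒜 1)) (X₂ := ModuleCat.of A A)
      (X₃ := ModuleCat.of A (zeroComponent 𝒜)) (ModuleCat.ofHom (idealGE 𝒜 1).subtype)
      (ModuleCat.ofHom (toZeroComponent 𝒜)) (by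
        ext a
        exact ker_toZeroComponent.ge a.2)
  have hS : S.ShortExact :=
    { exact := by
        rw [ShortComplex.moduleCat_exact_iff]
        exact fun x hx => ⟨⟨x, ker_toZeroComponent.le hx⟩, rfl⟩
      mono_f := (ModuleCat.mono_iff_injective _).2 Subtype.val_injective
      epi_g := (ModuleCat.epi_iff_surjective _).2
        (GradedRing.projZeroRingHom'_surjective 𝒜) }
  obtain ⟨ψ, hψ⟩ := Abelian.Ext.contravariant_sequence_exact₁ hS N (n₁ := 1)
    (Abelian.Ext.mk₀ (X := S.X₁) (ModuleCat.ofHom φ)) rfl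
    ((show Subsingleton (Abelian.Ext.{u} S.X₃ N 1) from h).elim _ _)
  obtain ⟨ψ, rfl⟩ := (Abelian.Ext.mk₀_bijective _ _).2 ψ
  rw [Abelian.Ext.mk₀_comp_mk₀] at hψ
  have e := (Abelian.Ext.mk₀_bijective _ _).1 hψ
  refine ⟨ψ (1 : A), fun a => ?_⟩
  have e' := congrArg (fun k : S.X₁ ⟶ N => k a) e
  refine Eq.trans e'.symm ?_
  change ψ.hom (a : A) = (a : A) • ψ.hom (1 : A)
  rw [← map_smul]
  exact congrArg ψ.hom (mul_one (a : A)).symm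

theorem isClosedModule_quotient_boundedTorsion
    (hfg : ∀ᶠ n in Filter.atTop, (idealGE 𝒜 n).FG)
    (h : Subsingleton (Abelian.Ext.{u} (zeroComponent 𝒜) (selfModTorsion 𝒜) 1)) :
    IsClosedModule 𝒜 (A ⧸ boundedTorsion 𝒜 A) := by
  refine IsClosedModule.of_torsionFree 𝒜 (boundedTorsion_quotient_eq_bot 𝒜 hfg) ?_
  unfold selfModTorsion at h
  rw [GrMod.torsionRadical_eq] at h
  exact exists_smul_eq_of_subsingleton_ext h

theorem IsClosedModule.directSum (hfp : (idealGE 𝒜 1).FG) {J : Type*} [DecidableEq J]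
    {X : J → Type*} [∀ j, AddCommGroup (X j)] [∀ j, Module A (X j)]
    (h : ∀ j, IsClosedModule 𝒜 (X j)) : IsClosedModule 𝒜 (⨁ j, X j) := by
  classical
  refine IsClosedModule.of_torsionFree 𝒜 ?_ fun φ => ?_
  · rw [eq_bot_iff]
    intro x hx
    refine DFinsupp.ext fun j => ?_
    have := map_mem_boundedTorsion 𝒜 (DirectSum.component A J X j) hx
    rw [(h j).torsionFree] at this
    exact this
  · obtain ⟨s, hs⟩ := Module.Finite.iff_fg.2 hfp
    choose x hx hx' using fun j => h j (DirectSum.component A J X j ∘ₗ φ)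
    -- Outside the supports of the values at the finitely many generators, the component of `φ` is
    -- zero, so uniqueness gives `x j = 0` and the `x j` form an element of the direct sum.
    have hzero : ∀ j ∉ s.biUnion fun g => (φ g).support, x j = 0 := by
      intro j hj
      refine (hx' j 0 fun a => ?_).symm
      have : DirectSum.component A J X j ∘ₗ φ = 0 := by
        refine LinearMap.ext_on hs fun g hg => ?_
        by_contra hne
        exact hj (Finset.mem_biUnion.2 ⟨g, hg, DFinsupp.mem_support_iff.2 hne⟩)
      rw [this, smul_zero, LinearMap.zero_apply]
    refine ⟨DFinsupp.mk (s.biUnion fun g => (φ g).support) fun j => x j, fun a =>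
      DFinsupp.ext fun j => (hx j a).trans ?_⟩
    rw [DirectSum.smul_apply]
    congr 1
    refine Eq.symm (DFinsupp.mk_apply.trans ?_)
    split_ifs with hj
    · rfl
    · exact (hzero j hj).symm

end

/-! ### Flat objects vanish -/

namespace GrMod

variable {A : Type u} [Ring A] {𝒜 : ℕ → AddSubgroup A}

/-- The morphism out of a quotient induced by a morphism that vanishes on the submodule. -/
def quotDesc {M Y : GrMod 𝒜} (N : Submodule A M) (hN : N.IsHomogeneous M.gr) (f : M ⟶ Y)
    (h : N ≤ LinearMap.ker (lin f)) : M.quotient N hN ⟶ Y :=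
  (⟨N.liftQ (lin f) h, by
    rintro n _ ⟨x, hx, rfl⟩
    exact lin_mem f n x hx⟩ : Hom (M.quotient N hN) Y)

theorem ringGr_of_neg {n : ℤ} (hn : n < 0) : ringGr 𝒜 n = ⊥ := by
  rcases n with n | n
  · exact absurd hn (by simp)
  · rfl

variable [GradedRing 𝒜]

/-- A torsion-free graded module is, up to torsion, a quotient of a closed graded module
that vanishes in any prescribed degree. -/
theorem exists_closed_cover (hfp : (idealGE 𝒜 1).FG)
    (hA : IsClosedModule 𝒜 (A ⧸ boundedTorsion 𝒜 A)) {M : GrMod 𝒜}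
    (hM : boundedTorsion 𝒜 M = ⊥) (e : ℤ) :
    ∃ (P : GrMod 𝒜) (π : P ⟶ M), IsClosedModule 𝒜 P ∧ P.gr e = ⊥ ∧
      ∀ y, ∃ n, ∀ a ∈ idealGE 𝒜 n, a • y ∈ LinearMap.range (lin π) := by
  classical
  -- One generator for each homogeneous element of degree `> e`. As `A` lives in degrees `≥ 0`, the
  -- resulting module has no component of degree `e`.
  let J := {p : ℤ × M // e < p.1 ∧ p.2 ∈ M.gr p.1}
  let X (j : J) : GrMod 𝒜 := (free 𝒜 j.1.1).quotient _ (boundedTorsion_isHomogeneous _)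
  let f (j : J) : X j ⟶ M := quotDesc _ _ (freeDesc M j.1.2 j.2.2) fun x hx => by
    have := map_mem_boundedTorsion 𝒜 (lin (freeDesc M j.1.2 j.2.2)) hx
    rw [hM] at this
    exact this
  refine ⟨sigma X, sigmaDesc X f, IsClosedModule.directSum hfp fun _ => hA, ?_, fun y => ?_⟩
  · rw [eq_bot_iff]
    refine fun x hx => DFinsupp.ext fun j => ?_
    obtain ⟨a, ha, h⟩ := hx j
    have ha' : a ∈ ringGr 𝒜 (e - j.1.1) := ha
    rw [ringGr_of_neg (by have := j.2.1; omega)] at ha'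
    obtain rfl : a = 0 := ha'
    rw [← h]
    exact map_zero _
  · induction y using induction_on_homogeneous with
    | zero => exact ⟨0, fun a _ => by rw [smul_zero]; exact zero_mem _⟩
    | add y z hy hz =>
      obtain ⟨m, hm⟩ := hy
      obtain ⟨n, hn⟩ := hz
      refine ⟨max m n, fun a ha => ?_⟩
      rw [smul_add]
      exact add_mem (hm a (idealGE_anti 𝒜 (le_max_left m n) ha))
        (hn a (idealGE_anti 𝒜 (le_max_right m n) ha))
    | homogeneous i y hy =>
      -- For `k ≥ (e - i).toNat + 1` the element `a • y` has degree `k + i > e`, so it is the image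
      -- of a generator.
      refine ⟨(e - i).toNat + 1, fun a ha => ?_⟩
      induction ha using idealGE_induction with
      | zero => rw [zero_smul]; exact zero_mem _
      | add a b _ _ ha hb => rw [add_smul]; exact add_mem ha hb
      | homogeneous k hk a ha =>
        let j : J := ⟨(k + i, a • y), by dsimp only; omega, M.smul_mem k i a y ha hy⟩
        refine ⟨DirectSum.lof A J (fun j => X j) j (Submodule.mkQ _ (gen 𝒜 (k + i))), ?_⟩
        exact (lin_sigmaDesc_lof X f j _).trans (lin_freeDesc_gen M (a • y) j.2.2)

attribute [local instance] Cardinal.fact_isRegular_aleph0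

/-- For `x` of degree `e` in `r F`, flatness lifts the morphism given by `x` to the image in `D` of
a cover `P` with `P_e = 0`. By adjunction `x` is then the image of an element of degree `e` of `r (q
P) ≅ P`. -/
theorem isZero_of_isFlatObject [(virtuallyFinitelyGraded 𝒜).IsSerreClass]
    (hfp : Module.FinitePresentation A (idealGE 𝒜 1))
    (hfg : ∀ᶠ n in Filter.atTop, (idealGE 𝒜 n).FG)
    (hExt : Subsingleton (Abelian.Ext.{u} (zeroComponent 𝒜) (selfModTorsion 𝒜) 1))
    {D : Type w} [Category.{v} D] (q : GrMod 𝒜 ⥤ D)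
    [q.IsLocalization (virtuallyFinitelyGraded 𝒜).isoModSerre] {F : D}
    (hF : IsFlatObject.{u} F) : IsZero F := by
  obtain ⟨r, adj, _, _, _, hr, hr'⟩ := exists_adjunction hfp hfg q
  have hM : ∀ x : r.obj F, x = 0 := by
    intro x
    induction x using induction_on_homogeneous with
    | zero => rfl
    | add x y hx hy => rw [hx, hy, add_zero]
    | homogeneous e x hx =>
      obtain ⟨P, π, hP, hPe, hπ⟩ := exists_closed_cover (Module.Finite.iff_fg.1 inferInstance)
        (isClosedModule_quotient_boundedTorsion hfg hExt) (hr F).torsionFree e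
      -- Although `π` itself need not be surjective, its cokernel is torsion, and maps into the
      -- torsion-free `r Y` cannot see torsion.
      have hepi : Epi ((adj.homEquiv P F).symm π) := ⟨fun {Y} g h hgh => r.map_injective <|
        lin_injective <| eq_of_comp_eq_of_torsion_coker (hr Y).torsionFree (lin π) hπ fun y => by
          have := congrArg (adj.homEquiv _ _) hgh
          rw [adj.homEquiv_naturality_right, adj.homEquiv_naturality_right,
            Equiv.apply_symm_apply] at this
          exact congrArg (fun k => lin k y) this⟩
      have : IsFinitelyPresentable.{u} (q.obj (free 𝒜 e)) :=
        adj.isCardinalPresentable_leftAdjoint_obj _ _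
      obtain ⟨g, hg⟩ := (hF _ hepi).2 _ this ((adj.homEquiv _ _).symm (freeDesc _ x hx))
      have hg' := congrArg (adj.homEquiv _ _) hg
      rw [adj.homEquiv_naturality_right, Equiv.apply_symm_apply] at hg'
      have := (adj.isIso_unit_app_iff_mem_essImage).2 (hr' P hP)
      let i : P ≅ r.obj (q.obj P) := asIso (adj.unit.app P)
      have hzero : lin i.inv (lin (adj.homEquiv _ _ g) (gen 𝒜 e)) = 0 := by
        have := lin_mem i.inv e _ (lin_mem (adj.homEquiv _ _ g) e _ (gen_mem e))
        rw [hPe] at this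
        exact this
      have hzero' : lin (adj.homEquiv _ _ g) (gen 𝒜 e) = 0 := by
        refine (congrArg (fun k => lin k (lin (adj.homEquiv _ _ g) (gen 𝒜 e)))
          i.inv_hom_id).symm.trans ?_
        exact (congrArg (lin i.hom) hzero).trans (map_zero _)
      rw [← lin_freeDesc_gen _ x hx, ← hg', lin_comp, hzero', map_zero]
  have hz : IsZero (r.obj F) := by
    rw [IsZero.iff_id_eq_zero]
    exact hom_ext hM
  let ff := Functor.FullyFaithful.ofFullyFaithful r
  exact ⟨fun Y => ⟨@Equiv.unique _ _ (hz.unique_to (r.obj Y)).some ff.homEquiv⟩,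
    fun Y => ⟨@Equiv.unique _ _ (hz.unique_from (r.obj Y)).some ff.homEquiv⟩⟩

end GrMod

theorem mainTheorem3 {A : Type u} [Ring A] (𝒜 : ℕ → AddSubgroup A) [GradedRing 𝒜]
    (hfp : Module.FinitePresentation A (idealGE 𝒜 1))
    (hfg : ∀ᶠ n in Filter.atTop, (idealGE 𝒜 n).FG) :
    ∃ _ : (GrMod.virtuallyFinitelyGraded 𝒜).IsSerreClass,
      ∀ (D : Type w) [Category.{v} D] (q : GrMod 𝒜 ⥤ D)
        [q.IsLocalization (GrMod.virtuallyFinitelyGraded 𝒜).isoModSerre],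
        IsLocallyFinitelyPresentable.{u} D ∧
        (Subsingleton (Abelian.Ext.{u} (zeroComponent 𝒜) (selfModTorsion 𝒜) 1) →
          ∀ F : D, IsFlatObject.{u} F → IsZero F) := by
  have := GrMod.isSerreClass hfg
  exact ⟨this, fun D _ q _ => ⟨GrMod.isLocallyFinitelyPresentable hfp hfg q,
    fun hExt F hF => GrMod.isZero_of_isFlatObject hfp hfg hExt q hF⟩⟩
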